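/- Let $-1<q<1$. Write $[n]_q=1+q+\dots+q^{n-1}$ (with $[0]_q=0$), $[n]_q!=\prod_{j=1}^n[j]_q$, $\binom{n}{k}_q=\frac{[n]_q!}{[n-k]_q!\,[k]_q!}$ for $0\le k\le n$, $(a)_n=\prod_{j=0}^{n-1}(1-aq^j)$, $(a)_\infty=\prod_{j\ge0}(1-aq^j)$. Let the $q$-Hermite polynomials be given by $H_{-1}(x|q)=0$, $H_0(x|q)=1$, $H_{n+1}(x|q)=xH_n(x|q)-[n]_qH_{n-1}(x|q)$, let $S_n(a,b|q)=\sum_{i=0}^n\binom{n}{i}_q a^ib^{n-i}$, and for $0\le m\le\lfloor n/2\rfloor$ let $$c_{m,n}(q)=\sum_{j=0}^m(-1)^jq^{j(j+1)/2}\Big(\binom{n}{m-j}-\binom{n}{m-j-1}\Big)\binom{n-2m+j}{j}_q ,\qquad \binom{n}{-1}=0.$$ Let $I_\nu(x)=\sum_{m\ge0}\frac{(x/2)^{2m+\nu}}{m!\,(m+\nu)!}$ ($\nu=0,1,2,\dots$) be the modified Bessel function of the first kind. (i) Let $y\in J(q)=[-2/\sqrt{1-q},\,2/\sqrt{1-q}]$,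 $|\rho|<1$, and let $X$ be a real random variable with the conditional $q$-Normal density $$f_{CN}(x|y,\rho,q)=\frac{\sqrt{1-q}\,(q)_\infty}{2\pi\sqrt{4-(1-q)x^2}}\prod_{k=0}^\infty\big((1+q^k)^2-(1-q)x^2q^k\big)\prod_{k=0}^\infty\frac{1-\rho^2q^k}{W_k(x,y|\rho,q)}$$ for $x\in J(q)$ and $0$ elsewhere, where $W_k(x,y|\rho,q)=(1-\rho^2q^{2k})^2-(1-q)\rho q^k(1+\rho^2q^{2k})xy+(1-q)\rho^2(x^2+y^2)q^{2k}$. Then all moments of $X$ exist and for every integer $n\ge0$ $$EX^n=\sum_{m=0}^{\lfloor n/2\rfloor}(1-q)^{-m}\rho^{n-2m}H_{n-2m}(y|q)\,c_{m,n}(q),$$ and for every real $t\ne0$ the expectation $E e^{tX}$ is finite, the series below converge (the inner one for each $k$, and then the outer one), and $$Ee^{tX}=\frac{\sqrt{1-q}}{t}\sum_{k=0}^\infty\frac{(1-q)^{k/2}}{[k]_q!}\rho^kH_k(y|q)\sum_{j=0}^\infty(-1)^j\frac{[k+j]_q!\,(k+2j+1)}{[j]_q!}\,q^{j(j+1)/2}\,I_{2j+k+1}\!\Big(\frac{2t}{\sqrt{1-q}}\Big).$$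 (ii) Let $a,b$ be real, $|a|,|b|<1$, and let $X$ be a real random variable with the density $$f_Q(x|a,b,q)=\frac{(q)_\infty(ab)_\infty}{2\pi\sqrt{1-x^2}}\prod_{k=0}^\infty\frac{(1+q^k)^2-4q^kx^2}{w_k(x|a,b,q)}$$ for $x\in[-1,1]$ and $0$ elsewhere, where $w_k(x|a,b,q)=(1+a^2q^{2k})(1+b^2q^{2k})-2x(a+b)q^k(1+abq^{2k})+4x^2abq^{2k}$. Then all moments of $X$ exist and for every integer $n\ge0$ $$EX^n=\frac1{2^n}\sum_{j=0}^{\lfloor n/2\rfloor}c_{j,n}(q)\,S_{n-2j}(a,b|q),$$ and for every real $t\ne0$ the expectation $Ee^{tX}$ is finite, the series below converge (in the same sense), and $$Ee^{tX}=\frac2t\sum_{k=0}^\infty\frac{S_k(a,b|q)}{(q)_k}\sum_{j=0}^\infty(-1)^j\frac{(q)_{k+j}\,(k+2j+1)}{(q)_j}\,q^{j(j+1)/2}\,I_{2j+k+1}(t).$$ -/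

import Mathlib

open MeasureTheory ProbabilityTheory

noncomputable section

/-- The `q`-number `[n]_q = 1 + q + ⋯ + q^(n-1)`. -/
def qNumber (q : ℝ) (n : ℕ) : ℝ := ∑ i ∈ Finset.range n, q ^ i

/-- The `q`-factorial `[n]_q! = ∏_{j=1}^n [j]_q`. -/
def qFactorial (q : ℝ) (n : ℕ) : ℝ := ∏ j ∈ Finset.range n, qNumber q (j + 1)

/-- The `q`-binomial coefficient, zero unless `k ≤ n`. -/
def qBinomial (q : ℝ) (n k : ℕ) : ℝ :=
  if k ≤ n then qFactorial q n / (qFactorial q (n - k) * qFactorial q k) else 0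

/-- The finite `q`-Pochhammer symbol `(a; q)_n = ∏_{j=0}^{n-1} (1 - a q^j)`. -/
def qPoch (a q : ℝ) (n : ℕ) : ℝ := ∏ j ∈ Finset.range n, (1 - a * q ^ j)

/-- The infinite `q`-Pochhammer symbol `(a; q)_∞ = ∏_{j ≥ 0} (1 - a q^j)`, for `|q| < 1`. -/
def qPochInf (a q : ℝ) : ℝ := ∏' j : ℕ, (1 - a * q ^ j)

/-- The interval `J(q) = [-2/√(1-q), 2/√(1-q)]`, for `|q| < 1`. -/
def qInterval (q : ℝ) : Set ℝ := Set.Icc (-(2 / √(1 - q))) (2 / √(1 - q))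

/-- The `q`-Hermite polynomials: `H_{-1} = 0`, `H_0 = 1`,
`H_{n+1}(x) = x H_n(x) - [n]_q H_{n-1}(x)`. -/
def qHermite (q : ℝ) : ℕ → ℝ → ℝ
  | 0, _ => 1
  | 1, x => x
  | n + 2, x => x * qHermite q (n + 1) x - qNumber q (n + 1) * qHermite q n x

/-- `S_n(a, b | q) = ∑_{i=0}^n [n choose i]_q a^i b^(n-i)`. -/
def qS (n : ℕ) (a b q : ℝ) : ℝ :=
  ∑ i ∈ Finset.range (n + 1), qBinomial q n i * a ^ i * b ^ (n - i)

/-- The coefficients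
`c_{m,n}(q) = ∑_{j=0}^m (-1)^j q^{j(j+1)/2} (C(n,m-j) - C(n,m-j-1)) [n-2m+j choose j]_q`,
for `2 m ≤ n`, where `C(n,-1) = 0`. -/
def qCoeff (m n : ℕ) (q : ℝ) : ℝ :=
  ∑ j ∈ Finset.range (m + 1),
    (-1) ^ j * q ^ (j * (j + 1) / 2) *
      ((n.choose (m - j) : ℝ) - (if j < m then (n.choose (m - j - 1) : ℝ) else 0)) *
      qBinomial q (n - 2 * m + j) j

/-- The modified Bessel function of the first kind `I_ν`, of order `ν ∈ ℕ`. -/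
def besselI (ν : ℕ) (x : ℝ) : ℝ :=
  ∑' m : ℕ, (x / 2) ^ (2 * m + ν) / ((m.factorial : ℝ) * ((m + ν).factorial : ℝ))

/-- The polynomial `w_k(x | a, b, q)`. -/
def smallW (k : ℕ) (x a b q : ℝ) : ℝ :=
  (1 + a ^ 2 * q ^ (2 * k)) * (1 + b ^ 2 * q ^ (2 * k))
    - 2 * x * (a + b) * q ^ k * (1 + a * b * q ^ (2 * k)) + 4 * x ^ 2 * a * b * q ^ (2 * k)

/-- The polynomial `W_k(x, y | ρ, q)`. -/
def bigW (k : ℕ) (x y ρ q : ℝ) : ℝ :=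
  (1 - ρ ^ 2 * q ^ (2 * k)) ^ 2 - (1 - q) * ρ * q ^ k * (1 + ρ ^ 2 * q ^ (2 * k)) * x * y
    + (1 - q) * ρ ^ 2 * (x ^ 2 + y ^ 2) * q ^ (2 * k)

/-- The `q`-Normal density `f_N(x | q)`, for `|q| < 1`. -/
def densityN (q x : ℝ) : ℝ :=
  (qInterval q).indicator (fun x => √(1 - q) * qPochInf q q / (2 * Real.pi * √(4 - (1 - q) * x ^ 2))
    * ∏' k : ℕ, ((1 + q ^ k) ^ 2 - (1 - q) * x ^ 2 * q ^ k)) x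

/-- The conditional `q`-Normal density `f_CN(x | y, ρ, q)`, for `|q| < 1`. -/
def densityCN (y ρ q x : ℝ) : ℝ :=
  densityN q x * ∏' k : ℕ, ((1 - ρ ^ 2 * q ^ k) / bigW k x y ρ q)

/-- The density `f_Q(x | a, b, q)`, for `|q| < 1`. -/
def densityQ (a b q x : ℝ) : ℝ :=
  (Set.Icc (-1 : ℝ) 1).indicator (fun x =>
    qPochInf q q * qPochInf (a * b) q / (2 * Real.pi * √(1 - x ^ 2))
      * ∏' k : ℕ, (((1 + q ^ k) ^ 2 - 4 * q ^ k * x ^ 2) / smallW k x a b q)) x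

/-- The measure on `ℝ` with (nonnegative) Lebesgue density `f`. -/
def measureOfDensity (f : ℝ → ℝ) : Measure ℝ :=
  volume.withDensity fun x => ENNReal.ofReal (f x)

/-- The `j`-th term of the inner series of the moment generating function of `f_CN`. -/
def innerCN (q t : ℝ) (k j : ℕ) : ℝ :=
  (-1) ^ j * (qFactorial q (k + j) * (k + 2 * j + 1) / qFactorial q j) *
    q ^ (j * (j + 1) / 2) * besselI (2 * j + k + 1) (2 * t / √(1 - q))

/-- The `j`-th term of the inner series of the moment generating function of `f_Q`. -/
def innerQ (q t : ℝ) (k j : ℕ) : ℝ :=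
  (-1) ^ j * (qPoch q q (k + j) * (k + 2 * j + 1) / qPoch q q j) *
    q ^ (j * (j + 1) / 2) * besselI (2 * j + k + 1) t

/-- The `k`-th term of the outer series of the moment generating function of `f_CN`. -/
def outerCN (y ρ q t : ℝ) (k : ℕ) : ℝ :=
  √(1 - q) ^ k / qFactorial q k * ρ ^ k * qHermite q k y * ∑' j : ℕ, innerCN q t k j

/-- The `k`-th term of the outer series of the moment generating function of `f_Q`. -/
def outerQ (a b q t : ℝ) (k : ℕ) : ℝ :=
  qS k a b q / qPoch q q k * ∑' j : ℕ, innerQ q t k j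

end

/-! ### Finite and infinite `q`-Pochhammer symbols -/

/-! Both laws are instances of one Al-Salam–Chihara law on [-1, 1], described by the sum `s` and
product `p` of two parameters in the open complex unit disc. In (ii) these are the real `a`, `b`; in
(i), after the substitution u = √(1-q) x / 2, they are ρ e^{iφ} and ρ e^{-iφ} with 2 cos φ = √(1-q)
y. `ascLaw` treats both at once.

With x = cos θ, the q-Mehler formula (`qMehler`) writes the density relative to dx / √(1 - x²) as
the q-Hermite weight times a series in products h_n(s, p) h_n(x) of normalised Rogers–Szegő
polynomials, converging uniformly in x (`ascWeight_eq`). The formula itself follows by iterating a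
functional equation that relates the series at `a` and at `q a`.

The Chebyshev polynomials U_n are the right test functions. Their integrals against finite products
of Hermite factors have a closed form (`truncMoment_even`), whose limit is (-1)^j q^{j(j+1)/2} for n
= 2j and 0 for odd n. Three-term recurrences extend this to the integrals of U_n h_k
(`mixedMoment_eq`), which vanish unless n - k is even and nonnegative. Integrating the Mehler series
term by term therefore leaves a finite sum for the integral of U_n (`integral_chebU_mul_ascWeight`).

The moments come from expanding (2x)^n in the U_{n-2m} with ballot numbers. The moment generating
function comes from e^{tx} = (2/t) ∑ (ν+1) I_{ν+1}(t) U_ν(x), integrated against the law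
(`hasSum_besselI_mul`), followed by a rearrangement of an absolutely convergent double series. -/

theorem qPoch_succ (a q : ℝ) (n : ℕ) : qPoch a q (n + 1) = qPoch a q n * (1 - a * q ^ n) :=
  Finset.prod_range_succ _ _

theorem qPoch_self_succ (q : ℝ) (n : ℕ) :
    qPoch q q (n + 1) = qPoch q q n * (1 - q ^ (n + 1)) := by
  rw [qPoch_succ, pow_succ']

theorem one_sub_pow_pos {q : ℝ} (hq : |q| < 1) {n : ℕ} (hn : n ≠ 0) : 0 < 1 - q ^ n := by
  have h : |q ^ n| < 1 := by rw [abs_pow]; exact pow_lt_one₀ (abs_nonneg q) hq hn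
  linarith [(abs_lt.1 h).2]

theorem qPoch_self_pos {q : ℝ} (hq : |q| < 1) (n : ℕ) : 0 < qPoch q q n := by
  refine Finset.prod_pos fun j _ => ?_
  rw [← pow_succ']
  exact one_sub_pow_pos hq j.succ_ne_zero

theorem summable_abs_const_mul_pow {q : ℝ} (hq : |q| < 1) (a : ℝ) :
    Summable fun k : ℕ => ‖-(a * q ^ k)‖ := by
  simp only [norm_neg, norm_mul, norm_pow]
  exact (summable_geometric_of_lt_one (norm_nonneg q) hq).mul_left _

theorem multipliable_qPochInf {q : ℝ} (hq : |q| < 1) (a : ℝ) :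
    Multipliable fun k : ℕ => 1 - a * q ^ k := by
  simpa [sub_eq_add_neg] using multipliable_one_add_of_summable (summable_abs_const_mul_pow hq a)

theorem tendsto_qPoch {q : ℝ} (hq : |q| < 1) (a : ℝ) :
    Filter.Tendsto (qPoch a q) Filter.atTop (nhds (qPochInf a q)) :=
  (multipliable_qPochInf hq a).hasProd.tendsto_prod_nat

theorem qPochInf_self_ne_zero {q : ℝ} (hq : |q| < 1) : qPochInf q q ≠ 0 := by
  have := tprod_one_add_ne_zero_of_summable (f := fun k : ℕ => -(q * q ^ k))
    (fun k => by
      rw [← sub_eq_add_neg, ← pow_succ']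
      exact (one_sub_pow_pos hq k.succ_ne_zero).ne') (summable_abs_const_mul_pow hq q)
  simpa [qPochInf, sub_eq_add_neg] using this

theorem qPochInf_self_pos {q : ℝ} (hq : |q| < 1) : 0 < qPochInf q q :=
  lt_of_le_of_ne (ge_of_tendsto' (tendsto_qPoch hq q) fun n => (qPoch_self_pos hq n).le)
    (qPochInf_self_ne_zero hq).symm

theorem exists_qPoch_self_le {q : ℝ} (hq : |q| < 1) : ∃ C, 1 ≤ C ∧ ∀ n, qPoch q q n ≤ C := by
  obtain ⟨C, hC⟩ := (tendsto_qPoch hq q).bddAbove_range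
  have h : ∀ n, qPoch q q n ≤ C := fun n => hC ⟨n, rfl⟩
  exact ⟨C, by simpa [qPoch] using h 0, h⟩

/-- The limit (q)_∞ is nonzero, so the inverses converge too. This bound and the previous one make
all later majorants uniform in the index. -/
theorem exists_inv_qPoch_self_le {q : ℝ} (hq : |q| < 1) :
    ∃ C, 1 ≤ C ∧ ∀ n, (qPoch q q n)⁻¹ ≤ C := by
  obtain ⟨C, hC⟩ := ((tendsto_qPoch hq q).inv₀ (qPochInf_self_ne_zero hq)).bddAbove_range
  have h : ∀ n, (qPoch q q n)⁻¹ ≤ C := fun n => hC ⟨n, rfl⟩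
  exact ⟨C, by simpa [qPoch] using h 0, h⟩

/-! ### Normalised Rogers–Szegő polynomials -/

/-- The homogeneous Rogers–Szegő polynomial, divided by `(q; q)_n`. -/
noncomputable def rogersSzego (q : ℝ) (a b : ℂ) (n : ℕ) : ℂ :=
  ∑ ij ∈ Finset.HasAntidiagonal.antidiagonal n, a ^ ij.1 / (qPoch q q ij.1 : ℂ) * (b ^ ij.2 / (qPoch q q ij.2 : ℂ))

/-- The real sequence with the three-term recurrence of `rogersSzego`, in terms of the sum `s` and
the product `p` of the two parameters. -/
noncomputable def rsSeq (q s p : ℝ) : ℕ → ℝ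
  | 0 => 1
  | 1 => s / (1 - q)
  | n + 2 => (s * rsSeq q s p (n + 1) - p * rsSeq q s p n) / (1 - q ^ (n + 2))

@[simp] theorem rogersSzego_zero (q : ℝ) (a b : ℂ) : rogersSzego q a b 0 = 1 := by
  simp [rogersSzego, qPoch]

theorem rogersSzego_comm (q : ℝ) (a b : ℂ) (n : ℕ) : rogersSzego q a b n = rogersSzego q b a n := by
  unfold rogersSzego
  rw [← Finset.Nat.sum_antidiagonal_swap]
  exact Finset.sum_congr rfl fun _ _ => mul_comm _ _

theorem one_sub_pow_mul_div_qPoch {q : ℝ} (hq : |q| < 1) (a : ℂ) (i : ℕ) :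
    (1 - (q : ℂ) ^ (i + 1)) * (a ^ (i + 1) / (qPoch q q (i + 1) : ℂ))
      = a * (a ^ i / (qPoch q q i : ℂ)) := by
  have h1 : ((qPoch q q i : ℝ) : ℂ) ≠ 0 := by exact_mod_cast (qPoch_self_pos hq i).ne'
  have h2 : (1 - (q : ℂ) ^ (i + 1)) ≠ 0 := by
    exact_mod_cast (one_sub_pow_pos hq i.succ_ne_zero).ne'
  rw [qPoch_self_succ]
  push_cast
  field_simp
  ring

/-- The polynomial is the T^n-coefficient of e(aT) e(bT) with e(z) = ∑ z^i / (q)_i, and e(z) - e(qz)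
= z e(z). -/
theorem rogersSzego_sub_smul {q : ℝ} (hq : |q| < 1) (a b : ℂ) (n : ℕ) :
    rogersSzego q a b (n + 1) - rogersSzego q (q * a) b (n + 1) = a * rogersSzego q a b n := by
  unfold rogersSzego
  rw [Finset.Nat.sum_antidiagonal_succ, Finset.Nat.sum_antidiagonal_succ, Finset.mul_sum]
  simp only [pow_zero, add_sub_add_left_eq_sub, ← Finset.sum_sub_distrib]
  refine Finset.sum_congr rfl fun ij _ => ?_
  rw [← mul_assoc, ← one_sub_pow_mul_div_qPoch hq a]
  ring

/-- Split 1 - q^(i+j) as (1 - q^i) + q^i (1 - q^j); each part lowers one of the two exponents. -/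
theorem rogersSzego_succ {q : ℝ} (hq : |q| < 1) (a b : ℂ) (n : ℕ) :
    (1 - (q : ℂ) ^ (n + 1)) * rogersSzego q a b (n + 1)
      = a * rogersSzego q a b n + b * rogersSzego q (q * a) b n := by
  have h : (1 - (q : ℂ) ^ (n + 1)) * rogersSzego q a b (n + 1) =
      (∑ ij ∈ Finset.HasAntidiagonal.antidiagonal (n + 1), (1 - (q : ℂ) ^ ij.1) * (a ^ ij.1 / (qPoch q q ij.1 : ℂ))
          * (b ^ ij.2 / (qPoch q q ij.2 : ℂ))) +
      ∑ ij ∈ Finset.HasAntidiagonal.antidiagonal (n + 1), (q * a) ^ ij.1 / (qPoch q q ij.1 : ℂ)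
          * ((1 - (q : ℂ) ^ ij.2) * (b ^ ij.2 / (qPoch q q ij.2 : ℂ))) := by
    rw [rogersSzego, Finset.mul_sum, ← Finset.sum_add_distrib]
    refine Finset.sum_congr rfl fun ij hij => ?_
    rw [← Finset.HasAntidiagonal.mem_antidiagonal.1 hij, pow_add]
    ring
  rw [h, Finset.Nat.sum_antidiagonal_succ, Finset.Nat.sum_antidiagonal_succ']
  simp only [pow_zero, sub_self, zero_mul, zero_add, mul_zero, rogersSzego,
    Finset.mul_sum, one_sub_pow_mul_div_qPoch hq]
  congr 1 <;> exact Finset.sum_congr rfl fun _ _ => by ring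

theorem rogersSzego_add_two {q : ℝ} (hq : |q| < 1) (a b : ℂ) (n : ℕ) :
    (1 - (q : ℂ) ^ (n + 2)) * rogersSzego q a b (n + 2)
      = (a + b) * rogersSzego q a b (n + 1) - a * b * rogersSzego q a b n := by
  linear_combination rogersSzego_succ hq a b (n + 1) - b * rogersSzego_sub_smul hq a b n

theorem rogersSzego_one {q : ℝ} (hq : |q| < 1) (a b : ℂ) :
    (1 - (q : ℂ)) * rogersSzego q a b 1 = a + b := by
  simpa using rogersSzego_succ hq a b 0

theorem rsSeq_one {q : ℝ} (hq : |q| < 1) (s p : ℝ) : (1 - q) * rsSeq q s p 1 = s := by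
  have h : 1 - q ≠ 0 := by simpa using (one_sub_pow_pos hq one_ne_zero).ne'
  rw [rsSeq]
  field_simp

theorem rsSeq_add_two {q : ℝ} (hq : |q| < 1) (s p : ℝ) (n : ℕ) :
    (1 - q ^ (n + 2)) * rsSeq q s p (n + 2) = s * rsSeq q s p (n + 1) - p * rsSeq q s p n := by
  have h : 1 - q ^ (n + 2) ≠ 0 := (one_sub_pow_pos hq (by omega)).ne'
  rw [rsSeq]
  field_simp

/-- Lets the integrals stay real while size estimates and product formulas use the possibly complex
parameters. -/
theorem ofReal_rsSeq {q : ℝ} (hq : |q| < 1) {s p : ℝ} {a b : ℂ} (hs : a + b = s) (hp : a * b = p)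
    (n : ℕ) : (rsSeq q s p n : ℂ) = rogersSzego q a b n := by
  induction n using Nat.twoStepInduction with
  | zero => simp [rsSeq]
  | one =>
    have h : (1 - (q : ℂ)) ≠ 0 := by
      exact_mod_cast (by simpa using (one_sub_pow_pos hq one_ne_zero).ne' : 1 - q ≠ 0)
    apply mul_left_cancel₀ h
    rw [rogersSzego_one hq, hs]
    exact_mod_cast rsSeq_one hq s p
  | more n h0 h1 =>
    have h : (1 - (q : ℂ) ^ (n + 2)) ≠ 0 := by
      exact_mod_cast (one_sub_pow_pos hq (n + 1).succ_ne_zero).ne'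
    apply mul_left_cancel₀ h
    rw [rogersSzego_add_two hq, hs, hp, ← h0, ← h1]
    exact_mod_cast rsSeq_add_two hq s p n

theorem exists_norm_rogersSzego_le {q : ℝ} (hq : |q| < 1) :
    ∃ C, 1 ≤ C ∧ ∀ (a b : ℂ) (r : ℝ), ‖a‖ ≤ r → ‖b‖ ≤ r → ∀ n,
      ‖rogersSzego q a b n‖ ≤ C * ((n + 1) * r ^ n) := by
  obtain ⟨C, hC1, hC⟩ := exists_inv_qPoch_self_le hq
  refine ⟨C * C, by nlinarith, fun a b r ha hb n => ?_⟩
  have hr : 0 ≤ r := (norm_nonneg a).trans ha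
  have h1 : ∀ (c : ℂ), ‖c‖ ≤ r → ∀ i, ‖c ^ i / (qPoch q q i : ℂ)‖ ≤ r ^ i * C := by
    intro c hc i
    rw [div_eq_mul_inv, norm_mul, norm_pow, norm_inv, Complex.norm_real,
      Real.norm_of_nonneg (qPoch_self_pos hq i).le]
    exact mul_le_mul (pow_le_pow_left₀ (norm_nonneg c) hc i) (hC i)
      (inv_nonneg.2 (qPoch_self_pos hq i).le) (pow_nonneg hr i)
  calc ‖rogersSzego q a b n‖ ≤ ∑ ij ∈ Finset.HasAntidiagonal.antidiagonal n, C * C * r ^ n := by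
        refine norm_sum_le_of_le _ fun ij hij => ?_
        rw [norm_mul, ← Finset.HasAntidiagonal.mem_antidiagonal.1 hij, pow_add]
        calc _ ≤ (r ^ ij.1 * C) * (r ^ ij.2 * C) :=
              mul_le_mul (h1 a ha _) (h1 b hb _) (norm_nonneg _) (by positivity)
          _ = _ := by ring
    _ = C * C * ((n + 1) * r ^ n) := by
        rw [Finset.sum_const, Finset.Nat.card_antidiagonal, nsmul_eq_mul]; push_cast; ring

/-! ### The `q`-Mehler formula -/

/-- The `n`-th term of the `q`-Mehler series. -/
noncomputable def mehlerTerm (q : ℝ) (a b z w : ℂ) (n : ℕ) : ℂ :=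
  qPoch q q n * rogersSzego q a b n * rogersSzego q z w n

theorem summable_succ_sq_mul_pow {r : ℝ} (h0 : 0 ≤ r) (h1 : r < 1) (C : ℝ) :
    Summable fun n : ℕ => C * ((n + 1) ^ 2 * r ^ n) := by
  have hr : ‖r‖ < 1 := by rwa [Real.norm_of_nonneg h0]
  have h := ((summable_pow_mul_geometric_of_norm_lt_one 2 hr).add
    ((summable_pow_mul_geometric_of_norm_lt_one 1 hr).mul_left 2)).add
    (summable_geometric_of_lt_one h0 h1)
  exact (h.congr fun n => by ring).mul_left C

theorem exists_norm_mehlerTerm_le {q : ℝ} (hq : |q| < 1) :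
    ∃ C, ∀ (a b z w : ℂ) (r : ℝ), ‖a‖ ≤ r → ‖b‖ ≤ r → ‖z‖ ≤ 1 → ‖w‖ ≤ 1 → ∀ n,
      ‖mehlerTerm q a b z w n‖ ≤ C * ((n + 1) ^ 2 * r ^ n) := by
  obtain ⟨C, hC1, hC⟩ := exists_norm_rogersSzego_le hq
  obtain ⟨D, hD1, hD⟩ := exists_qPoch_self_le hq
  refine ⟨D * C * C, fun a b z w r ha hb hz hw n => ?_⟩
  have hr : 0 ≤ r := (norm_nonneg a).trans ha
  have h1 := hC a b r ha hb n
  have h2 := hC z w 1 hz hw n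
  rw [one_pow, mul_one] at h2
  rw [mehlerTerm, norm_mul, norm_mul, Complex.norm_real, Real.norm_of_nonneg (qPoch_self_pos hq n).le]
  calc _ ≤ D * (C * ((n + 1) * r ^ n)) * (C * (n + 1)) :=
        mul_le_mul (mul_le_mul (hD n) h1 (norm_nonneg _) (by positivity)) h2 (norm_nonneg _)
          (by positivity)
    _ = _ := by ring

theorem summable_mehlerTerm {q : ℝ} (hq : |q| < 1) {a b z w : ℂ} (ha : ‖a‖ < 1) (hb : ‖b‖ < 1)
    (hz : ‖z‖ ≤ 1) (hw : ‖w‖ ≤ 1) : Summable (mehlerTerm q a b z w) := by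
  obtain ⟨C, hC⟩ := exists_norm_mehlerTerm_le hq
  exact (summable_succ_sq_mul_pow (le_max_of_le_left (norm_nonneg a)) (max_lt ha hb) C).of_norm_bounded
    (hC a b z w _ (le_max_left _ _) (le_max_right _ _) hz hw)

theorem norm_smul_pow_lt {q : ℝ} (hq : |q| < 1) {a : ℂ} (ha : ‖a‖ < 1) (n : ℕ) :
    ‖(q : ℂ) ^ n * a‖ < 1 := by
  rw [norm_mul, norm_pow, Complex.norm_real]
  exact (mul_le_of_le_one_left (norm_nonneg a) (pow_le_one₀ (norm_nonneg q) hq.le)).trans_lt ha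

/-- Write F, F' for the series at `a` and `q a`. The q-difference in `a` turns F - F' into `a` times
a series with shifted index in (z, w). The three-term recurrence in (z, w) evaluates that series as
(z + w) F - z w (a F + b F'), and solving for F gives the factors. -/
theorem tsum_mehlerTerm_functional {q : ℝ} (hq : |q| < 1) {a b z w : ℂ} (ha : ‖a‖ < 1)
    (hb : ‖b‖ < 1) (hz : ‖z‖ ≤ 1) (hw : ‖w‖ ≤ 1) :
    (1 - a * z) * (1 - a * w) * ∑' n, mehlerTerm q a b z w n
      = (1 - a * b * (z * w)) * ∑' n, mehlerTerm q (q * a) b z w n := by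
  have hqa : ‖(q : ℂ) * a‖ < 1 := by simpa using norm_smul_pow_lt hq ha 1
  have hF := (summable_mehlerTerm hq ha hb hz hw).hasSum
  have hF' := (summable_mehlerTerm hq hqa hb hz hw).hasSum
  set F := ∑' n, mehlerTerm q a b z w n
  set F' := ∑' n, mehlerTerm q (q * a) b z w n
  have hF1 := (hasSum_nat_add_iff' 1).2 hF
  have hF1' := (hasSum_nat_add_iff' 1).2 hF'
  -- The recurrence needs two earlier indices, so the tail is summed here and the initial term is
  -- restored in `hX'`.
  have hX : HasSum (fun n => (qPoch q q (n + 1) : ℂ) * rogersSzego q a b (n + 1) *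
      ((1 - (q : ℂ) ^ (n + 2)) * rogersSzego q z w (n + 2)))
      ((z + w) * (F - 1) - z * w * (a * F + b * F')) := by
    convert! (hF1.mul_left (z + w)).sub (((hF.mul_left a).add (hF'.mul_left b)).mul_left (z * w))
      using 1
    · ext n
      rw [rogersSzego_add_two hq]
      simp only [mehlerTerm]
      have h := rogersSzego_succ hq a b n
      rw [qPoch_self_succ]
      push_cast
      linear_combination (-(z * w) * (qPoch q q n : ℂ) * rogersSzego q z w n) * h
    · simp [mehlerTerm, qPoch]
  have hX' : HasSum (fun n => (qPoch q q n : ℂ) * rogersSzego q a b n *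
      ((1 - (q : ℂ) ^ (n + 1)) * rogersSzego q z w (n + 1)))
      ((z + w) * F - z * w * (a * F + b * F')) := by
    rw [← hasSum_nat_add_iff' 1]
    convert! hX using 1
    simp [qPoch, rogersSzego_one hq]
    ring
  have h := (hF1.sub hF1').unique (a₂ := a * ((z + w) * F - z * w * (a * F + b * F'))) (by
    convert! hX'.mul_left a using 1
    ext n
    simp only [mehlerTerm]
    have h := rogersSzego_sub_smul hq a b n
    rw [qPoch_self_succ]
    push_cast
    linear_combination
      ((qPoch q q n : ℂ) * (1 - (q : ℂ) ^ (n + 1)) * rogersSzego q z w (n + 1)) * h)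
  simp [mehlerTerm, qPoch] at h
  linear_combination h

theorem prod_mul_tsum_mehlerTerm {q : ℝ} (hq : |q| < 1) {a b z w : ℂ} (ha : ‖a‖ < 1)
    (hb : ‖b‖ < 1) (hz : ‖z‖ ≤ 1) (hw : ‖w‖ ≤ 1) (N : ℕ) :
    (∏ k ∈ Finset.range N, (1 - a * z * (q : ℂ) ^ k) * (1 - a * w * (q : ℂ) ^ k)) *
        ∑' n, mehlerTerm q a b z w n
      = (∏ k ∈ Finset.range N, (1 - a * b * (z * w) * (q : ℂ) ^ k)) *
        ∑' n, mehlerTerm q ((q : ℂ) ^ N * a) b z w n := by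
  induction N with
  | zero => simp
  | succ N ih =>
    have h := tsum_mehlerTerm_functional hq (norm_smul_pow_lt hq ha N) hb hz hw
    rw [← mul_assoc (q : ℂ), ← pow_succ'] at h
    rw [Finset.prod_range_succ, Finset.prod_range_succ]
    linear_combination (1 - a * z * (q : ℂ) ^ N) * (1 - a * w * (q : ℂ) ^ N) * ih +
      (∏ k ∈ Finset.range N, (1 - a * b * (z * w) * (q : ℂ) ^ k)) * h

/-- Since q^N a stays in the ball of radius max(‖a‖, ‖b‖) < 1, one summable majorant serves every N.
-/
theorem tendsto_tsum_mehlerTerm {q : ℝ} (hq : |q| < 1) {a b z w : ℂ} (ha : ‖a‖ < 1)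
    (hb : ‖b‖ < 1) (hz : ‖z‖ ≤ 1) (hw : ‖w‖ ≤ 1) :
    Filter.Tendsto (fun N : ℕ => ∑' n, mehlerTerm q ((q : ℂ) ^ N * a) b z w n) Filter.atTop
      (nhds (∑' n, mehlerTerm q 0 b z w n)) := by
  obtain ⟨C, hC⟩ := exists_norm_mehlerTerm_le hq
  have hr : max ‖a‖ ‖b‖ < 1 := max_lt ha hb
  refine tendsto_tsum_of_dominated_convergence
    (summable_succ_sq_mul_pow (le_max_of_le_left (norm_nonneg a)) hr C) (fun n => ?_)
    (Filter.Eventually.of_forall fun N n => hC _ b z w _ ?_ (le_max_right _ _) hz hw n)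
  · have hc : Continuous fun c : ℂ => mehlerTerm q c b z w n := by
      unfold mehlerTerm rogersSzego
      fun_prop
    have h0 : Filter.Tendsto (fun N : ℕ => (q : ℂ) ^ N * a) Filter.atTop (nhds 0) := by
      have := tendsto_pow_atTop_nhds_zero_of_norm_lt_one (x := (q : ℂ)) (by simpa using hq)
      simpa using this.mul_const a
    exact (hc.tendsto 0).comp h0
  · rw [norm_mul, norm_pow, Complex.norm_real]
    exact (mul_le_of_le_one_left (norm_nonneg a) (pow_le_one₀ (norm_nonneg q) hq.le)).trans
      (le_max_left _ _)

theorem multipliable_one_sub_mul_pow {q : ℝ} (hq : |q| < 1) (c : ℂ) :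
    Multipliable fun k : ℕ => 1 - c * (q : ℂ) ^ k := by
  have : Summable fun k : ℕ => ‖-(c * (q : ℂ) ^ k)‖ := by
    simp only [norm_neg, norm_mul, norm_pow, Complex.norm_real]
    exact (summable_geometric_of_lt_one (norm_nonneg q) hq).mul_left _
  simpa [sub_eq_add_neg] using multipliable_one_add_of_summable this

theorem tendsto_prod_one_sub_mul_pow {q : ℝ} (hq : |q| < 1) (c : ℂ) :
    Filter.Tendsto (fun N => ∏ k ∈ Finset.range N, (1 - c * (q : ℂ) ^ k)) Filter.atTop
      (nhds (∏' k : ℕ, (1 - c * (q : ℂ) ^ k))) :=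
  (multipliable_one_sub_mul_pow hq c).hasProd.tendsto_prod_nat

theorem tprod_mul_tsum_mehlerTerm {q : ℝ} (hq : |q| < 1) {a b z w : ℂ} (ha : ‖a‖ < 1)
    (hb : ‖b‖ < 1) (hz : ‖z‖ ≤ 1) (hw : ‖w‖ ≤ 1) :
    (∏' k : ℕ, (1 - a * z * (q : ℂ) ^ k)) * (∏' k : ℕ, (1 - a * w * (q : ℂ) ^ k)) *
        ∑' n, mehlerTerm q a b z w n
      = (∏' k : ℕ, (1 - a * b * (z * w) * (q : ℂ) ^ k)) * ∑' n, mehlerTerm q 0 b z w n := by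
  have hl := ((tendsto_prod_one_sub_mul_pow hq (a * z)).mul
    (tendsto_prod_one_sub_mul_pow hq (a * w))).mul_const (∑' n, mehlerTerm q a b z w n)
  have hr := (tendsto_prod_one_sub_mul_pow hq (a * b * (z * w))).mul
    (tendsto_tsum_mehlerTerm hq ha hb hz hw)
  refine tendsto_nhds_unique hl (hr.congr fun N => ?_)
  rw [← prod_mul_tsum_mehlerTerm hq ha hb hz hw N, Finset.prod_mul_distrib]

theorem mehlerTerm_comm (q : ℝ) (a b z w : ℂ) : mehlerTerm q a b z w = mehlerTerm q b a z w := by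
  ext n
  rw [mehlerTerm, mehlerTerm, rogersSzego_comm]

theorem tsum_mehlerTerm_zero_zero (q : ℝ) (z w : ℂ) : ∑' n, mehlerTerm q 0 0 z w n = 1 := by
  rw [tsum_eq_single 0]
  · simp [mehlerTerm, qPoch]
  · intro n hn
    have : rogersSzego q 0 0 n = 0 := by
      refine Finset.sum_eq_zero fun ij hij => ?_
      rw [Finset.HasAntidiagonal.mem_antidiagonal] at hij
      rcases eq_or_ne ij.1 0 with h | h
      · have : ij.2 ≠ 0 := by omega
        simp [this]
      · simp [h]
    simp [mehlerTerm, this]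

/-- The `q`-Mehler formula. -/
theorem qMehler {q : ℝ} (hq : |q| < 1) {a b z w : ℂ} (ha : ‖a‖ < 1)
    (hb : ‖b‖ < 1) (hz : ‖z‖ ≤ 1) (hw : ‖w‖ ≤ 1) :
    (∏' k : ℕ, (1 - a * z * (q : ℂ) ^ k)) * (∏' k : ℕ, (1 - a * w * (q : ℂ) ^ k)) *
        ((∏' k : ℕ, (1 - b * z * (q : ℂ) ^ k)) * (∏' k : ℕ, (1 - b * w * (q : ℂ) ^ k))) *
        ∑' n, mehlerTerm q a b z w n
      = ∏' k : ℕ, (1 - a * b * (z * w) * (q : ℂ) ^ k) := by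
  -- One application sends `a` to 0; a second one, by symmetry, sends `b` to 0, where the series
  -- equals 1.
  have h1 := tprod_mul_tsum_mehlerTerm hq ha hb hz hw
  have h2 := tprod_mul_tsum_mehlerTerm hq hb (a := b) (b := 0) (by simp) hz hw
  rw [tsum_mehlerTerm_zero_zero] at h2
  simp only [mul_zero, zero_mul, sub_zero, tprod_one, mul_one, mehlerTerm_comm q b 0] at h2
  linear_combination ((∏' k : ℕ, (1 - b * z * (q : ℂ) ^ k)) *
    (∏' k : ℕ, (1 - b * w * (q : ℂ) ^ k))) * h1 +
    (∏' k : ℕ, (1 - a * b * (z * w) * (q : ℂ) ^ k)) * h2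

/-- The Mehler identity with b = 0, z = 1, w = 0 exhibits an inverse: the product times a series
equals 1. -/
theorem tprod_one_sub_mul_pow_ne_zero {q : ℝ} (hq : |q| < 1) {a : ℂ} (ha : ‖a‖ < 1) :
    ∏' k : ℕ, (1 - a * (q : ℂ) ^ k) ≠ 0 := by
  have h := tprod_mul_tsum_mehlerTerm hq ha (a := a) (b := 0) (z := 1) (w := 0) (by simp)
    (by simp) (by simp)
  rw [tsum_mehlerTerm_zero_zero] at h
  intro h0
  simp [h0] at h

/-! ### The weights and the real form of the `q`-Mehler formula -/

/-- The `k`-th factor of the denominator of the Al-Salam–Chihara density, in terms of the sum `s`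
and the product `p` of the parameters. -/
def ascFactor (q s p : ℝ) (k : ℕ) (x : ℝ) : ℝ :=
  1 + (s ^ 2 - 2 * p) * q ^ (2 * k) + p ^ 2 * q ^ (4 * k)
    - 2 * x * s * q ^ k * (1 + p * q ^ (2 * k)) + 4 * x ^ 2 * p * q ^ (2 * k)

/-- The `k`-th factor of the weight of the continuous `q`-Hermite polynomials. -/
def hermiteFactor (q : ℝ) (k : ℕ) (x : ℝ) : ℝ := (1 + q ^ k) ^ 2 - 4 * q ^ k * x ^ 2

theorem multipliable_one_add_quartic {q : ℝ} (hq : |q| < 1) (c₁ c₂ c₃ c₄ : ℝ) :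
    Multipliable fun k : ℕ =>
      1 + (c₁ * q ^ k + c₂ * (q ^ k) ^ 2 + c₃ * (q ^ k) ^ 3 + c₄ * (q ^ k) ^ 4) := by
  have h : ∀ (c : ℝ) (m : ℕ), m ≠ 0 → Summable fun k : ℕ => c * (q ^ k) ^ m := fun c m hm => by
    have : |q ^ m| < 1 := by rw [abs_pow]; exact pow_lt_one₀ (abs_nonneg q) hq hm
    exact ((summable_geometric_of_abs_lt_one this).mul_left c).congr fun k => by
      rw [← pow_mul, ← pow_mul, mul_comm m k]
  have h4 := (((h c₁ 1 (by simp)).add (h c₂ 2 (by simp))).add (h c₃ 3 (by simp))).add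
    (h c₄ 4 (by simp))
  simp only [pow_one] at h4
  exact Real.multipliable_one_add_of_summable h4

theorem multipliable_ascFactor {q : ℝ} (hq : |q| < 1) (s p x : ℝ) :
    Multipliable fun k => ascFactor q s p k x := by
  refine (multipliable_one_add_quartic hq (-2 * x * s) (s ^ 2 - 2 * p + 4 * x ^ 2 * p)
    (-2 * x * s * p) (p ^ 2)).congr fun k => ?_
  rw [ascFactor, mul_comm 2 k, mul_comm 4 k, pow_mul, pow_mul]
  ring

theorem multipliable_hermiteFactor {q : ℝ} (hq : |q| < 1) (x : ℝ) :
    Multipliable fun k => hermiteFactor q k x := by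
  refine (multipliable_one_add_quartic hq (2 - 4 * x ^ 2) 1 0 0).congr fun k => ?_
  rw [hermiteFactor]
  ring

theorem hermiteFactor_nonneg {q : ℝ} (hq : |q| < 1) (k : ℕ) {x : ℝ} (hx : x ∈ Set.Icc (-1 : ℝ) 1) :
    0 ≤ hermiteFactor q k x := by
  have hx2 : x ^ 2 ≤ 1 := by nlinarith [hx.1, hx.2]
  have h : |q ^ k| ≤ 1 := by rw [abs_pow]; exact pow_le_one₀ (abs_nonneg q) hq.le
  rw [hermiteFactor]
  nlinarith [sq_nonneg (1 - q ^ k), sq_nonneg x, sq_nonneg (1 + q ^ k)]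

/-- The `n`-th term of the `q`-Mehler series, in real form. -/
noncomputable def mehlerSeries (q s p x : ℝ) (n : ℕ) : ℝ :=
  qPoch q q n * rsSeq q s p n * rsSeq q (2 * x) 1 n

section
variable {q s p : ℝ} {a b : ℂ}

/-- The witnesses are e^{iθ} and e^{-iθ} with θ = arccos x. -/
theorem exists_unit_add_inv {x : ℝ} (hx : x ∈ Set.Icc (-1 : ℝ) 1) :
    ∃ z w : ℂ, ‖z‖ ≤ 1 ∧ ‖w‖ ≤ 1 ∧ z + w = ((2 * x : ℝ) : ℂ) ∧ z * w = ((1 : ℝ) : ℂ) ∧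
      w = starRingEnd ℂ z := by
  refine ⟨Complex.exp (Real.arccos x * Complex.I), Complex.exp (-(Real.arccos x) * Complex.I),
    (Complex.norm_exp_ofReal_mul_I _).le, ?_, ?_, ?_, ?_⟩
  · have := Complex.norm_exp_ofReal_mul_I (-(Real.arccos x))
    push_cast at this
    exact this.le
  · rw [← Complex.two_cos, ← Complex.ofReal_cos, Real.cos_arccos hx.1 hx.2]
    push_cast; rfl
  · rw [← Complex.exp_add]; simp
  · rw [← Complex.exp_conj]; simp

theorem ofReal_ascFactor {x : ℝ} {z w : ℂ} (hs : a + b = s) (hp : a * b = p)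
    (hzw : z + w = ((2 * x : ℝ) : ℂ)) (hzw1 : z * w = ((1 : ℝ) : ℂ)) (k : ℕ) :
    (ascFactor q s p k x : ℂ) = (1 - a * z * (q : ℂ) ^ k) * (1 - a * w * (q : ℂ) ^ k) *
      ((1 - b * z * (q : ℂ) ^ k) * (1 - b * w * (q : ℂ) ^ k)) := by
  push_cast at hzw hzw1
  have h1 : ∀ c : ℂ, (1 - c * z * (q : ℂ) ^ k) * (1 - c * w * (q : ℂ) ^ k)
      = 1 - 2 * x * c * (q : ℂ) ^ k + c ^ 2 * ((q : ℂ) ^ k) ^ 2 := fun c => by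
    linear_combination (-c * (q : ℂ) ^ k) * hzw + c ^ 2 * ((q : ℂ) ^ k) ^ 2 * hzw1
  rw [h1, h1, ascFactor, mul_comm 2 k, mul_comm 4 k, pow_mul, pow_mul]
  push_cast
  rw [← hs, ← hp]
  ring

theorem ofReal_mehlerSeries (hq : |q| < 1) {x : ℝ} {z w : ℂ} (hs : a + b = s) (hp : a * b = p)
    (hzw : z + w = ((2 * x : ℝ) : ℂ)) (hzw1 : z * w = ((1 : ℝ) : ℂ)) (n : ℕ) :
    (mehlerSeries q s p x n : ℂ) = mehlerTerm q a b z w n := by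
  rw [mehlerSeries, mehlerTerm]
  push_cast
  rw [ofReal_rsSeq hq hs hp, ofReal_rsSeq hq hzw hzw1]

theorem exists_abs_mehlerSeries_le (hq : |q| < 1) (ha : ‖a‖ < 1) (hb : ‖b‖ < 1) (hs : a + b = s)
    (hp : a * b = p) : ∃ B : ℕ → ℝ, Summable B ∧ ∀ x ∈ Set.Icc (-1 : ℝ) 1, ∀ n,
      |mehlerSeries q s p x n| ≤ B n := by
  obtain ⟨C, hC⟩ := exists_norm_mehlerTerm_le hq
  refine ⟨_, summable_succ_sq_mul_pow (le_max_of_le_left (norm_nonneg a)) (max_lt ha hb) C,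
    fun x hx n => ?_⟩
  obtain ⟨z, w, hz, hw, hzw, hzw1, -⟩ := exists_unit_add_inv hx
  rw [← Real.norm_eq_abs, ← Complex.norm_real, ofReal_mehlerSeries hq hs hp hzw hzw1]
  exact hC a b z w _ (le_max_left _ _) (le_max_right _ _) hz hw n

/-- Each factor splits into four linear ones, giving the four products of `qMehler`. Nonvanishing is
what permits splitting the infinite product of quotients later. -/
theorem tprod_ascFactor_ne_zero_and_mul_tsum (hq : |q| < 1) (ha : ‖a‖ < 1) (hb : ‖b‖ < 1)
    (hs : a + b = s) (hp : a * b = p) {x : ℝ} (hx : x ∈ Set.Icc (-1 : ℝ) 1) :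
    ∏' k, ascFactor q s p k x ≠ 0 ∧
      (∏' k, ascFactor q s p k x) * ∑' n, mehlerSeries q s p x n = qPochInf p q := by
  obtain ⟨z, w, hz, hw, hzw, hzw1, -⟩ := exists_unit_add_inv hx
  have hc : ((∏' k, ascFactor q s p k x : ℝ) : ℂ) =
      (∏' k : ℕ, (1 - a * z * (q : ℂ) ^ k)) * (∏' k : ℕ, (1 - a * w * (q : ℂ) ^ k)) *
        ((∏' k : ℕ, (1 - b * z * (q : ℂ) ^ k)) * (∏' k : ℕ, (1 - b * w * (q : ℂ) ^ k))) := by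
    have h1 := (Complex.continuous_ofReal.tendsto _).comp
      (multipliable_ascFactor hq s p x).hasProd.tendsto_prod_nat
    have h2 := ((tendsto_prod_one_sub_mul_pow hq (a * z)).mul
      (tendsto_prod_one_sub_mul_pow hq (a * w))).mul ((tendsto_prod_one_sub_mul_pow hq (b * z)).mul
      (tendsto_prod_one_sub_mul_pow hq (b * w)))
    refine tendsto_nhds_unique h1 (h2.congr fun N => ?_)
    simp only [Function.comp, Complex.ofReal_prod, ofReal_ascFactor hs hp hzw hzw1,
      Finset.prod_mul_distrib]
  have hlt : ∀ {c v : ℂ}, ‖c‖ < 1 → ‖v‖ ≤ 1 → ‖c * v‖ < 1 := fun hc hv => by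
    rw [norm_mul]
    exact (mul_le_of_le_one_right (norm_nonneg _) hv).trans_lt hc
  constructor
  · rw [← Complex.ofReal_ne_zero, hc]
    exact mul_ne_zero (mul_ne_zero (tprod_one_sub_mul_pow_ne_zero hq (hlt ha hz))
      (tprod_one_sub_mul_pow_ne_zero hq (hlt ha hw))) (mul_ne_zero
      (tprod_one_sub_mul_pow_ne_zero hq (hlt hb hz)) (tprod_one_sub_mul_pow_ne_zero hq (hlt hb hw)))
  · apply Complex.ofReal_injective
    rw [Complex.ofReal_mul, hc, Complex.ofReal_tsum]
    simp only [ofReal_mehlerSeries hq hs hp hzw hzw1]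
    rw [qMehler hq ha hb hz hw]
    have h1 := (Complex.continuous_ofReal.tendsto _).comp (tendsto_qPoch hq p)
    refine tendsto_nhds_unique (tendsto_prod_one_sub_mul_pow hq _) (h1.congr fun N => ?_)
    simp [qPoch, hp, hzw1]

theorem qPochInf_mul_tprod_div (hq : |q| < 1) (ha : ‖a‖ < 1) (hb : ‖b‖ < 1)
    (hs : a + b = s) (hp : a * b = p) {x : ℝ} (hx : x ∈ Set.Icc (-1 : ℝ) 1) :
    qPochInf p q * ∏' k, (hermiteFactor q k x / ascFactor q s p k x)
      = (∏' k, hermiteFactor q k x) * ∑' n, mehlerSeries q s p x n := by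
  obtain ⟨h0, h1⟩ := tprod_ascFactor_ne_zero_and_mul_tsum hq ha hb hs hp hx
  rw [(multipliable_hermiteFactor hq x).tprod_div₀ (multipliable_ascFactor hq s p x) h0, ← h1]
  field_simp

end

/-! ### Chebyshev polynomials of the second kind under the `q`-Hermite weight -/

section
open Polynomial.Chebyshev

/-- The Chebyshev polynomials of the second kind, as functions. -/
noncomputable def chebU (n : ℤ) (x : ℝ) : ℝ := (U ℝ n).eval x

theorem continuous_chebU (n : ℤ) : Continuous (chebU n) := Polynomial.continuous _

@[simp] theorem chebU_zero (x : ℝ) : chebU 0 x = 1 := by simp [chebU]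

@[simp] theorem chebU_neg_one (x : ℝ) : chebU (-1) x = 0 := by simp [chebU]

theorem chebU_neg_two (x : ℝ) : chebU (-2) x = -1 := by simp [chebU]

theorem two_mul_chebU (n : ℤ) (x : ℝ) : 2 * x * chebU n x = chebU (n + 1) x + chebU (n - 1) x := by
  have := congrArg (Polynomial.eval x) (U_add_one ℝ n)
  simp at this
  simp only [chebU]
  linarith

theorem four_mul_sq_mul_chebU (n : ℤ) (x : ℝ) :
    4 * x ^ 2 * chebU n x = chebU (n + 2) x + 2 * chebU n x + chebU (n - 2) x := by
  have h0 := two_mul_chebU n x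
  have h1 := two_mul_chebU (n + 1) x
  have h2 := two_mul_chebU (n - 1) x
  rw [add_sub_cancel_right, add_assoc] at h1
  rw [sub_add_cancel, sub_sub] at h2
  norm_num at h1 h2
  linear_combination 2 * x * h0 + h1 + h2

theorem abs_chebU_le (n : ℕ) {x : ℝ} (hx : x ∈ Set.Icc (-1 : ℝ) 1) : |chebU n x| ≤ n + 1 := by
  induction n using Nat.twoStepInduction with
  | zero => simp
  | one =>
    have := abs_le.2 ⟨hx.1, hx.2⟩
    have h2 : chebU 1 x = 2 * x := by simp [chebU]
    rw [Nat.cast_one, h2, abs_mul, abs_two]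
    norm_num
    linarith
  | more n h0 h1 =>
    have h := congrArg (Polynomial.eval x) (U_eq_two_mul_T_add_U ℝ n)
    rw [Polynomial.eval_add, Polynomial.eval_mul, Polynomial.eval_ofNat] at h
    have hT := abs_eval_T_real_le_one (n + 2) (abs_le.2 ⟨hx.1, hx.2⟩)
    have h' : chebU ((n + 2 : ℕ) : ℤ) x = 2 * (T ℝ (n + 2)).eval x + chebU n x := by
      simp only [chebU]
      push_cast
      exact h
    rw [h']
    refine (abs_add_le _ _).trans ?_
    rw [abs_mul, abs_two]
    push_cast
    linarith

/-! ### Chebyshev moments of the truncated q-Hermite weight -/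

theorem integral_eval_T (n : ℤ) :
    ∫ x, (T ℝ n).eval x ∂measureT = if n = 0 then Real.pi else 0 := by
  split_ifs with h
  · rw [h]; exact integral_eval_T_real_measureT_zero
  · exact integral_eval_T_real_measureT_of_ne_zero h

theorem ae_measureT_mem_Icc : ∀ᵐ x ∂measureT, x ∈ Set.Icc (-1 : ℝ) 1 := by
  rw [measureT]
  exact (ae_restrict_mem measurableSet_Ioc).mono fun x hx => ⟨hx.1.le, hx.2⟩

instance : IsFiniteMeasure measureT := by
  have : Integrable (fun _ : ℝ => (1 : ℝ)) measureT := integrable_measureT continuousOn_const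
  simpa using (integrable_const_iff.1 this)

theorem integrable_measureT_of_continuous {f : ℝ → ℝ} (hf : Continuous f) :
    Integrable f measureT := integrable_measureT hf.continuousOn

/-- The integral of a Chebyshev polynomial against the truncated `q`-Hermite weight. -/
noncomputable def truncMoment (q : ℝ) (N : ℕ) (n : ℤ) : ℝ :=
  (2 * Real.pi)⁻¹ *
    ∫ x, (∏ k ∈ Finset.range (N + 1), hermiteFactor q k x) * chebU n x ∂measureT

theorem continuous_hermiteFactor (q : ℝ) (k : ℕ) : Continuous (hermiteFactor q k) := by
  unfold hermiteFactor
  fun_prop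

/-- Level 0 already contains the factor k = 0, which is 4(1 - x²), and 4(1 - x²) U_n = 2(T_n -
T_{n+2}). Orthogonality to T_0 finishes. -/
theorem truncMoment_zero (q : ℝ) (n : ℤ) :
    truncMoment q 0 n = (if n = 0 then 1 else 0) - (if n + 2 = 0 then 1 else 0) := by
  have h : ∀ x : ℝ, (∏ k ∈ Finset.range (0 + 1), hermiteFactor q k x) * chebU n x
      = 2 * ((T ℝ n).eval x - (T ℝ (n + 2)).eval x) := fun x => by
    have h1 := congrArg (Polynomial.eval x) (one_sub_X_sq_mul_U_eq_pol_in_T ℝ n)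
    have h2 := congrArg (Polynomial.eval x) (T_add_two ℝ n)
    simp only [Polynomial.eval_mul, Polynomial.eval_sub, Polynomial.eval_one, Polynomial.eval_pow,
      Polynomial.eval_X, Polynomial.eval_ofNat] at h1 h2
    simp only [zero_add, Finset.prod_range_one, hermiteFactor, pow_zero, chebU]
    linear_combination 4 * h1 - 2 * h2
  simp only [truncMoment, h]
  rw [integral_const_mul, integral_sub, integral_eval_T, integral_eval_T]
  · have := Real.pi_ne_zero
    split_ifs <;> field_simp <;> simp
  · exact integrable_measureT_of_continuous (Polynomial.continuous _)
  · exact integrable_measureT_of_continuous (Polynomial.continuous _)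

/-- Multiplication by 4x² sends U_n to U_{n+2} + 2 U_n + U_{n-2}, so a new factor acts as a
second-order difference operator on the index. -/
theorem truncMoment_succ (q : ℝ) (N : ℕ) (n : ℤ) :
    truncMoment q (N + 1) n = (1 + (q ^ (N + 1)) ^ 2) * truncMoment q N n
      - q ^ (N + 1) * (truncMoment q N (n + 2) + truncMoment q N (n - 2)) := by
  have hi : ∀ m : ℤ, Integrable
      (fun x => (∏ k ∈ Finset.range (N + 1), hermiteFactor q k x) * chebU m x) measureT := fun m =>
    integrable_measureT_of_continuous
      ((continuous_finsetProd _ fun k _ => continuous_hermiteFactor q k).mul (continuous_chebU m))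
  have h : ∀ x : ℝ, (∏ k ∈ Finset.range (N + 1 + 1), hermiteFactor q k x) * chebU n x
      = (1 + (q ^ (N + 1)) ^ 2) * ((∏ k ∈ Finset.range (N + 1), hermiteFactor q k x) * chebU n x)
      - q ^ (N + 1) * ((∏ k ∈ Finset.range (N + 1), hermiteFactor q k x) * chebU (n + 2) x +
        (∏ k ∈ Finset.range (N + 1), hermiteFactor q k x) * chebU (n - 2) x) := fun x => by
    rw [Finset.prod_range_succ, hermiteFactor]
    linear_combination (-(q ^ (N + 1)) * ∏ k ∈ Finset.range (N + 1), hermiteFactor q k x) *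
      four_mul_sq_mul_chebU n x
  simp only [truncMoment, h]
  rw [integral_sub ((hi n).const_mul _) (Integrable.const_mul (by exact (hi _).add (hi _)) _), integral_const_mul,
    integral_const_mul, integral_add (hi _) (hi _)]
  ring

theorem truncMoment_neg_two (q : ℝ) (N : ℕ) : truncMoment q N (-2) = -truncMoment q N 0 := by
  simp [truncMoment, chebU_neg_two, integral_neg]

theorem truncMoment_odd (q : ℝ) (N : ℕ) {n : ℤ} (hn : Odd n) : truncMoment q N n = 0 := by
  induction N generalizing n with
  | zero =>
    obtain ⟨m, rfl⟩ := hn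
    rw [truncMoment_zero, if_neg (by omega), if_neg (by omega), sub_zero]
  | succ N ih =>
    rw [truncMoment_succ, ih hn, ih (hn.add_even (by decide)), ih (hn.sub_even (by decide))]
    simp

theorem triangle_succ (j : ℕ) : (j + 1) * (j + 1 + 1) / 2 = j * (j + 1) / 2 + (j + 1) := by
  rw [show (j + 1) * (j + 1 + 1) = j * (j + 1) + (j + 1) * 2 by ring,
    Nat.add_mul_div_right _ _ two_pos]

/-- A finite form of the Jacobi triple product, by induction on N. The variable `d` stands for N -
j, avoiding truncated subtraction. -/
theorem truncMoment_even {q : ℝ} (hq : |q| < 1) (N : ℕ) :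
    (∀ j d : ℕ, j + d = N → truncMoment q N ((2 * j : ℕ) : ℤ) = (-1) ^ j * q ^ (j * (j + 1) / 2) *
      (qPoch q q (2 * N + 1) / (qPoch q q d * qPoch q q (N + j + 1)))) ∧
    ∀ j : ℕ, N < j → truncMoment q N ((2 * j : ℕ) : ℤ) = 0 := by
  have hP : ∀ n, qPoch q q n ≠ 0 := fun n => (qPoch_self_pos hq n).ne'
  have hone : ∀ n, 1 - q ^ (n + 1) ≠ 0 := fun n => (one_sub_pow_pos hq n.succ_ne_zero).ne'
  induction N with
  | zero =>
    constructor
    · intro j d hjd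
      obtain ⟨rfl, rfl⟩ : j = 0 ∧ d = 0 := by omega
      rw [truncMoment_zero]
      have := hone 0
      simp [qPoch] at this ⊢
      field_simp
    · intro j hj
      rw [truncMoment_zero, if_neg (by omega), if_neg (by omega), sub_zero]
  | succ N ih =>
    obtain ⟨ih1, ih2⟩ := ih
    have hN : qPoch q q (2 * (N + 1) + 1)
        = qPoch q q (2 * N + 1) * (1 - q ^ (2 * N + 2)) * (1 - q ^ (2 * N + 3)) := by
      rw [show 2 * (N + 1) + 1 = 2 * N + 1 + 1 + 1 by ring, qPoch_self_succ, qPoch_self_succ]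
    constructor
    · intro j d hjd
      rw [truncMoment_succ, hN]
      -- At j = 0 the recurrence reaches index -2, and the reflection U_{-2} = -U_0 closes it.
      rcases j with _ | i
      · obtain rfl : d = N + 1 := by omega
        rw [show ((2 * 0 : ℕ) : ℤ) - 2 = -2 by norm_num, truncMoment_neg_two,
          show ((2 * 0 : ℕ) : ℤ) + 2 = (2 * 1 : ℕ) by norm_num,
          show (0 : ℤ) = (2 * 0 : ℕ) by norm_num, ih1 0 N (by omega)]
        rcases N with _ | N
        · rw [ih2 1 (by omega)]
          have h1 := hone 0
          have h2 := hone 1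
          simp [qPoch, Finset.prod_range_succ] at h1 h2 ⊢
          rw [← pow_two q]
          field_simp
          ring
        · rw [ih1 1 N (by omega)]
          simp only [show N + 1 + 1 + 1 + 0 = N + 1 + 1 + 1 by ring, Nat.add_zero, zero_add,
            qPoch_self_succ q N, qPoch_self_succ q (N + 1),
            qPoch_self_succ q (N + 1 + 1)]
          have hD := hP N
          have hF := hP (2 * (N + 1) + 1)
          have h1 := hone N
          have h2 := hone (N + 1)
          have h3 := hone (N + 1 + 1)
          norm_num
          field_simp
          ring
      · rw [show ((2 * (i + 1) : ℕ) : ℤ) - 2 = (2 * i : ℕ) by push_cast; ring,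
          show ((2 * (i + 1) : ℕ) : ℤ) + 2 = (2 * (i + 2) : ℕ) by push_cast; ring,
          ih1 i d (by omega)]
        obtain rfl : N = i + d := by omega
        -- Near the top degree, level-N moments in the recurrence vanish: two of them for d = 0, one
        -- for d = 1.
        rcases d with _ | _ | d
        · rw [ih2 (i + 1) (by omega), ih2 (i + 2) (by omega), triangle_succ]
          have hF := hP (2 * (i + 0) + 1)
          rw [show i + 0 + 1 + (i + 1) + 1 = 2 * (i + 0) + 1 + 1 + 1 by ring,
            show i + 0 + i + 1 = 2 * (i + 0) + 1 by ring,
            qPoch_self_succ q (2 * (i + 0) + 1 + 1), qPoch_self_succ q (2 * (i + 0) + 1)]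
          have h1 := hone (2 * (i + 0) + 1)
          have h2 := hone (2 * (i + 0) + 2)
          have hD := hP 0
          field_simp
          ring
        · rw [ih1 (i + 1) 0 (by omega), ih2 (i + 2) (by omega), triangle_succ]
          have hF := hP (i + (0 + 1) + i + 1)
          rw [show i + (0 + 1) + 1 + (i + 1) + 1 = i + (0 + 1) + i + 1 + 1 + 1 by ring,
            show i + (0 + 1) + (i + 1) + 1 = i + (0 + 1) + i + 1 + 1 by ring,
            qPoch_self_succ q (i + (0 + 1) + i + 1 + 1), qPoch_self_succ q (i + (0 + 1) + i + 1),
            qPoch_self_succ q 0]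
          have h1 := hone (i + (0 + 1) + i + 1)
          have h2 := hone (i + (0 + 1) + i + 2)
          have h3 := hone 0
          have hD := hP 0
          field_simp
          ring
        · rw [ih1 (i + 1) (d + 1) (by omega), ih1 (i + 2) d (by omega), triangle_succ (i + 1),
            triangle_succ]
          have hF := hP (i + (d + 1 + 1) + i + 1)
          rw [show i + (d + 1 + 1) + 1 + (i + 1) + 1 = i + (d + 1 + 1) + i + 1 + 1 + 1 by ring,
            show i + (d + 1 + 1) + (i + 1) + 1 = i + (d + 1 + 1) + i + 1 + 1 by ring,
            show i + (d + 1 + 1) + (i + 2) + 1 = i + (d + 1 + 1) + i + 1 + 1 + 1 by ring,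
            qPoch_self_succ q (i + (d + 1 + 1) + i + 1 + 1),
            qPoch_self_succ q (i + (d + 1 + 1) + i + 1),
            qPoch_self_succ q (d + 1), qPoch_self_succ q d]
          have h1 := hone (i + (d + 1 + 1) + i + 1)
          have h2 := hone (i + (d + 1 + 1) + i + 2)
          have h3 := hone d
          have h4 := hone (d + 1)
          have hD := hP d
          field_simp
          ring
    · intro j hj
      obtain ⟨i, rfl⟩ : ∃ i, j = i + 1 := ⟨j - 1, by omega⟩
      rw [truncMoment_succ, show ((2 * (i + 1) : ℕ) : ℤ) - 2 = (2 * i : ℕ) by push_cast; ring,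
        show ((2 * (i + 1) : ℕ) : ℤ) + 2 = (2 * (i + 2) : ℕ) by push_cast; ring,
        ih2 i (by omega), ih2 (i + 1) (by omega), ih2 (i + 2) (by omega)]
      simp
end

section
open Polynomial.Chebyshev

/-! ### The `q`-Hermite weight -/

/-- The density of the `q`-Hermite orthogonality measure with respect to `measureT`. -/
noncomputable def hermiteWeight (q x : ℝ) : ℝ :=
  qPochInf q q / (2 * Real.pi) * ∏' k, hermiteFactor q k x

theorem tendsto_prod_hermiteFactor {q : ℝ} (hq : |q| < 1) (x : ℝ) :
    Filter.Tendsto (fun N => ∏ k ∈ Finset.range N, hermiteFactor q k x) Filter.atTop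
      (nhds (∏' k, hermiteFactor q k x)) :=
  (multipliable_hermiteFactor hq x).hasProd.tendsto_prod_nat

theorem measurable_hermiteWeight {q : ℝ} (hq : |q| < 1) : Measurable (hermiteWeight q) := by
  refine Measurable.const_mul ?_ _
  refine measurable_of_tendsto_metrizable (fun N => ?_)
    (tendsto_pi_nhds.2 fun x => tendsto_prod_hermiteFactor hq x)
  exact (continuous_finsetProd _ fun k _ => continuous_hermiteFactor q k).measurable

/-- On [-1, 1] each factor lies between 0 and (1 + |q|^k)², whose partial products converge. The
bound dominates the passage N → ∞. -/
theorem exists_abs_prod_hermiteFactor_le {q : ℝ} (hq : |q| < 1) :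
    ∃ C, ∀ x ∈ Set.Icc (-1 : ℝ) 1, ∀ N, |∏ k ∈ Finset.range N, hermiteFactor q k x| ≤ C := by
  have hq' : |(|q|)| < 1 := by rwa [abs_abs]
  have hm := (multipliable_one_add_quartic hq' 2 1 0 0).hasProd.tendsto_prod_nat
  obtain ⟨C, hC⟩ := hm.bddAbove_range
  refine ⟨C, fun x hx N => le_trans ?_ (hC ⟨N, rfl⟩)⟩
  rw [Finset.abs_prod]
  refine Finset.prod_le_prod (fun _ _ => abs_nonneg _) fun k _ => ?_
  rw [abs_of_nonneg (hermiteFactor_nonneg hq k hx), hermiteFactor, ← abs_pow]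
  have hx2 : x ^ 2 ≤ 1 := by nlinarith [hx.1, hx.2]
  have h1 : -|q ^ k| ≤ q ^ k := neg_abs_le _
  have h2 : q ^ k ≤ |q ^ k| := le_abs_self _
  have h3 : (q ^ k) ^ 2 = |q ^ k| ^ 2 := (sq_abs _).symm
  nlinarith [sq_nonneg x, mul_nonneg (sub_nonneg.2 h2) (sub_nonneg.2 hx2),
    mul_nonneg (sub_nonneg.2 h1) (sq_nonneg x)]

theorem exists_abs_hermiteWeight_le {q : ℝ} (hq : |q| < 1) :
    ∃ C, ∀ x ∈ Set.Icc (-1 : ℝ) 1, |hermiteWeight q x| ≤ C := by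
  obtain ⟨C, hC⟩ := exists_abs_prod_hermiteFactor_le hq
  refine ⟨|qPochInf q q / (2 * Real.pi)| * C, fun x hx => ?_⟩
  rw [hermiteWeight, abs_mul]
  exact mul_le_mul_of_nonneg_left
    (le_of_tendsto' ((continuous_abs.tendsto _).comp (tendsto_prod_hermiteFactor hq x))
      (hC x hx)) (abs_nonneg _)

theorem integrable_hermiteWeight {q : ℝ} (hq : |q| < 1) :
    Integrable (hermiteWeight q) measureT := by
  obtain ⟨C, hC⟩ := exists_abs_hermiteWeight_le hq
  exact Integrable.of_bound (measurable_hermiteWeight hq).aestronglyMeasurable C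
    (ae_measureT_mem_Icc.mono hC)

theorem Integrable.continuous_mul_of_ae_mem_Icc {μ : Measure ℝ}
    (hμ : ∀ᵐ x ∂μ, x ∈ Set.Icc (-1 : ℝ) 1) {f g : ℝ → ℝ} (hf : Continuous f)
    (hg : Integrable g μ) : Integrable (fun x => f x * g x) μ := by
  obtain ⟨C, hC⟩ := isCompact_Icc.exists_bound_of_continuousOn (s := Set.Icc (-1 : ℝ) 1)
    hf.continuousOn
  exact hg.bdd_mul hf.aestronglyMeasurable (hμ.mono hC)

theorem tendsto_truncMoment {q : ℝ} (hq : |q| < 1) (n : ℤ) :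
    Filter.Tendsto (fun N => qPochInf q q * truncMoment q N n) Filter.atTop
      (nhds (∫ x, chebU n x * hermiteWeight q x ∂measureT)) := by
  obtain ⟨C, hC⟩ := exists_abs_prod_hermiteFactor_le hq
  have h : Filter.Tendsto
      (fun N => ∫ x, (∏ k ∈ Finset.range (N + 1), hermiteFactor q k x) * chebU n x ∂measureT)
      Filter.atTop (nhds (∫ x, (∏' k, hermiteFactor q k x) * chebU n x ∂measureT)) := by
    refine tendsto_integral_of_dominated_convergence (fun x => C * ‖chebU n x‖) (fun N => ?_)
      ?_ (fun N => ?_) ?_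
    · exact ((continuous_finsetProd _ fun k _ => continuous_hermiteFactor q k).mul
        (continuous_chebU n)).aestronglyMeasurable
    · exact (integrable_measureT_of_continuous (continuous_chebU n)).norm.const_mul C
    · filter_upwards [ae_measureT_mem_Icc] with x hx
      rw [norm_mul]
      exact mul_le_mul_of_nonneg_right (hC x hx _) (norm_nonneg _)
    · exact Filter.Eventually.of_forall fun x =>
        (((Filter.tendsto_add_atTop_iff_nat 1).2 (tendsto_prod_hermiteFactor hq x))).mul_const _
  have h2 := (h.const_mul (2 * Real.pi)⁻¹).const_mul (qPochInf q q)
  convert! h2 using 2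
  rw [← integral_const_mul, ← integral_const_mul]
  congr 1
  ext x
  rw [hermiteWeight]
  ring

theorem integral_chebU_odd_mul_hermiteWeight {q : ℝ} (hq : |q| < 1) {n : ℤ} (hn : Odd n) :
    ∫ x, chebU n x * hermiteWeight q x ∂measureT = 0 := by
  refine tendsto_nhds_unique (tendsto_truncMoment hq n) ?_
  simp [truncMoment_odd q _ hn]

/-- All three q-Pochhammer indices in `truncMoment_even` tend to infinity, so the quotient tends to
1 / (q)_∞, cancelled by the normalisation. -/
theorem integral_chebU_even_mul_hermiteWeight {q : ℝ} (hq : |q| < 1) (j : ℕ) :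
    ∫ x, chebU ((2 * j : ℕ) : ℤ) x * hermiteWeight q x ∂measureT
      = (-1) ^ j * q ^ (j * (j + 1) / 2) := by
  have h1 := (Filter.tendsto_add_atTop_iff_nat j).2 (tendsto_truncMoment hq ((2 * j : ℕ) : ℤ))
  have hP := tendsto_qPoch hq q
  have h0 := qPochInf_self_ne_zero hq
  have ht : ∀ f : ℕ → ℕ, (∀ n, n ≤ f n) →
      Filter.Tendsto (fun n => qPoch q q (f n)) Filter.atTop (nhds (qPochInf q q)) := fun f hf =>
    hP.comp (Filter.tendsto_atTop_mono hf Filter.tendsto_id)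
  have h2 := (((ht (fun d => 2 * (d + j) + 1) (fun n => by omega)).div
    (hP.mul (ht (fun d => d + j + j + 1) (fun n => by omega))) (mul_ne_zero h0 h0)).const_mul
    ((-1) ^ j * q ^ (j * (j + 1) / 2))).const_mul (qPochInf q q)
  refine (tendsto_nhds_unique h1 (h2.congr fun d => ?_)).trans ?_
  · rw [(truncMoment_even hq (d + j)).1 j d (by ring)]
    rfl
  · field_simp

/-! ### Mixed moments of Chebyshev and `q`-Hermite polynomials -/

theorem continuous_rsSeq (q p : ℝ) (k : ℕ) : Continuous fun x => rsSeq q (2 * x) p k := by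
  induction k using Nat.twoStepInduction with
  | zero => simpa [rsSeq] using continuous_const
  | one => simp only [rsSeq]; fun_prop
  | more n h0 h1 => simp only [rsSeq]; fun_prop

/-- The integral of the product of a Chebyshev polynomial and a normalised `q`-Hermite polynomial
with respect to the `q`-Hermite weight. -/
noncomputable def mixedMoment (q : ℝ) (n : ℤ) (k : ℕ) : ℝ :=
  ∫ x, chebU n x * rsSeq q (2 * x) 1 k * hermiteWeight q x ∂measureT

theorem integrable_mixedMoment {q : ℝ} (hq : |q| < 1) (n : ℤ) (k : ℕ) :
    Integrable (fun x => chebU n x * rsSeq q (2 * x) 1 k * hermiteWeight q x) measureT :=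
  Integrable.continuous_mul_of_ae_mem_Icc ae_measureT_mem_Icc
    ((continuous_chebU n).mul (continuous_rsSeq q 1 k)) (integrable_hermiteWeight hq)

theorem mixedMoment_neg_one (q : ℝ) (k : ℕ) : mixedMoment q (-1) k = 0 := by
  simp [mixedMoment]

theorem mixedMoment_one {q : ℝ} (hq : |q| < 1) (n : ℤ) :
    (1 - q) * mixedMoment q n 1 = mixedMoment q (n + 1) 0 + mixedMoment q (n - 1) 0 := by
  simp only [mixedMoment]
  rw [← integral_const_mul, ← integral_add (integrable_mixedMoment hq _ _)
    (integrable_mixedMoment hq _ _)]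
  congr 1
  ext x
  have h := rsSeq_one hq (2 * x) 1
  simp only [rsSeq] at h ⊢
  linear_combination chebU n x * hermiteWeight q x * h + hermiteWeight q x * two_mul_chebU n x

theorem mixedMoment_add_two {q : ℝ} (hq : |q| < 1) (n : ℤ) (k : ℕ) :
    (1 - q ^ (k + 2)) * mixedMoment q n (k + 2) =
      mixedMoment q (n + 1) (k + 1) + mixedMoment q (n - 1) (k + 1) - mixedMoment q n k := by
  simp only [mixedMoment]
  rw [← integral_const_mul, ← integral_add (integrable_mixedMoment hq _ _)
    (integrable_mixedMoment hq _ _), ← integral_sub (by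
      exact (integrable_mixedMoment hq _ _).add (integrable_mixedMoment hq _ _))
      (integrable_mixedMoment hq _ _)]
  congr 1
  ext x
  have h := rsSeq_add_two hq (2 * x) 1 k
  linear_combination chebU n x * hermiteWeight q x * h +
    rsSeq q (2 * x) 1 (k + 1) * hermiteWeight q x * two_mul_chebU n x

/-- Two-step induction on k from the pure Chebyshev moments; orthogonality of the q-Hermite
polynomials is not used. The range includes n = -1, where U_{-1} = 0, because the recurrence lowers
n. -/
theorem mixedMoment_eq {q : ℝ} (hq : |q| < 1) (k : ℕ) :
    (∀ j : ℕ, mixedMoment q ((k + 2 * j : ℕ) : ℤ) k = (-1) ^ j * q ^ (j * (j + 1) / 2) *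
      (qPoch q q (k + j) / (qPoch q q k * qPoch q q j))) ∧
    ∀ n : ℤ, -1 ≤ n → (∀ j : ℕ, n ≠ (k + 2 * j : ℕ)) → mixedMoment q n k = 0 := by
  have hP : ∀ n, qPoch q q n ≠ 0 := fun n => (qPoch_self_pos hq n).ne'
  have hone : ∀ n, 1 - q ^ (n + 1) ≠ 0 := fun n => (one_sub_pow_pos hq n.succ_ne_zero).ne'
  have hP0 : qPoch q q 0 = 1 := by simp [qPoch]
  have hz : ∀ (k : ℕ) (n : ℤ), (0 ≤ n → mixedMoment q n k = 0) → -1 ≤ n →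
      mixedMoment q n k = 0 := fun k n h hn => by
    rcases hn.eq_or_lt with rfl | hn
    · exact mixedMoment_neg_one q k
    · exact h (by omega)
  have hzero : (∀ j : ℕ, mixedMoment q ((0 + 2 * j : ℕ) : ℤ) 0 = (-1) ^ j * q ^ (j * (j + 1) / 2) *
      (qPoch q q (0 + j) / (qPoch q q 0 * qPoch q q j))) ∧
      ∀ n : ℤ, -1 ≤ n → (∀ j : ℕ, n ≠ (0 + 2 * j : ℕ)) → mixedMoment q n 0 = 0 := by
    constructor
    · intro j
      have h := integral_chebU_even_mul_hermiteWeight hq j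
      have := hP j
      rw [zero_add, zero_add, hP0, one_mul, div_self this, mul_one, ← h]
      simp [mixedMoment, rsSeq]
    · intro n hn hj
      refine hz 0 n (fun hn0 => ?_) hn
      have hodd : Odd n := by
        rw [← Int.not_even_iff_odd]
        rintro ⟨m, rfl⟩
        exact hj m.toNat (by omega)
      simpa [mixedMoment, rsSeq] using integral_chebU_odd_mul_hermiteWeight hq hodd
  induction k using Nat.twoStepInduction with
  | zero => exact hzero
  | one =>
    obtain ⟨e0, z0⟩ := hzero
    have h1 := hone 0
    rw [zero_add, pow_one] at h1
    constructor
    · intro j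
      apply mul_left_cancel₀ h1
      rw [mixedMoment_one hq,
        show ((1 + 2 * j : ℕ) : ℤ) + 1 = (0 + 2 * (j + 1) : ℕ) by push_cast; ring,
        show ((1 + 2 * j : ℕ) : ℤ) - 1 = (0 + 2 * j : ℕ) by push_cast; ring, e0, e0, triangle_succ,
        add_comm 1 j, zero_add, zero_add, hP0, show qPoch q q 1 = 1 - q by simp [qPoch],
        qPoch_self_succ]
      have h2 := hone j
      have h3 := hP j
      field_simp
      ring
    · intro n hn hj
      refine hz 1 n (fun hn0 => ?_) hn
      apply mul_left_cancel₀ h1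
      rw [mixedMoment_one hq, z0 (n + 1) (by omega), z0 (n - 1) (by omega)]
      · simp
      · intro j hj'
        exact hj j (by push_cast at hj' ⊢; omega)
      · intro j hj'
        exact hj (j - 1) (by push_cast at hj' ⊢; omega)
  | more k h0 h1 =>
    obtain ⟨e0, z0⟩ := h0
    obtain ⟨e1, z1⟩ := h1
    have hk := hone (k + 1)
    constructor
    · intro j
      apply mul_left_cancel₀ hk
      rw [mixedMoment_add_two hq,
        show ((k + 2 + 2 * j : ℕ) : ℤ) + 1 = (k + 1 + 2 * (j + 1) : ℕ) by push_cast; ring,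
        show ((k + 2 + 2 * j : ℕ) : ℤ) - 1 = (k + 1 + 2 * j : ℕ) by push_cast; ring,
        show ((k + 2 + 2 * j : ℕ) : ℤ) = (k + 2 * (j + 1) : ℕ) by push_cast; ring,
        e1, e1, e0, triangle_succ, show k + 2 + j = k + j + 1 + 1 by ring,
        show k + 1 + (j + 1) = k + j + 1 + 1 by ring, show k + 1 + j = k + j + 1 by ring,
        show k + (j + 1) = k + j + 1 by ring, qPoch_self_succ q (k + j + 1),
        qPoch_self_succ q (k + 1), qPoch_self_succ q k, qPoch_self_succ q j]
      have h2 := hone j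
      have h3 := hP j
      have h4 := hone k
      have h5 := hP k
      have h6 := hP (k + j + 1)
      field_simp
      ring
    · intro n hn hj
      refine hz (k + 2) n (fun hn0 => ?_) hn
      apply mul_left_cancel₀ hk
      have hm : mixedMoment q (n - 1) (k + 1) = 0 := z1 (n - 1) (by omega) fun j hj' =>
        hj j (by push_cast at hj' ⊢; omega)
      rw [mixedMoment_add_two hq, hm]
      -- For n = k the two surviving moments both equal 1 and cancel; elsewhere every term vanishes.
      rcases eq_or_ne n k with rfl | hnk
      · have a1 := e1 0
        have a0 := e0 0
        simp only [mul_zero, add_zero] at a0 a1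
        push_cast at a1
        rw [a1, a0, hP0]
        have h4 := hP k
        have h5 := hP (k + 1)
        field_simp
        simp
      · rw [z1 (n + 1) (by omega), z0 n hn]
        · simp
        · intro j hj'
          rcases j with _ | j
          · exact hnk (by simpa using hj')
          · exact hj j (by push_cast at hj' ⊢; omega)
        · intro j hj'
          rcases j with _ | j
          · exact hnk (by push_cast at hj'; omega)
          · exact hj j (by push_cast at hj' ⊢; omega)
end

section
open Polynomial.Chebyshev

/-! ### The Al-Salam–Chihara weight -/

theorem one_sub_mul_qNumber (q : ℝ) (n : ℕ) : (1 - q) * qNumber q n = 1 - q ^ n :=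
  mul_neg_geom_sum q n

theorem qPoch_self_eq_qFactorial (q : ℝ) (n : ℕ) : qPoch q q n = (1 - q) ^ n * qFactorial q n := by
  rw [qPoch, qFactorial, ← Finset.card_range n, ← Finset.prod_const, Finset.card_range,
    ← Finset.prod_mul_distrib]
  refine Finset.prod_congr rfl fun j _ => ?_
  rw [one_sub_mul_qNumber, pow_succ']

theorem one_sub_pos_of_abs_lt_one {q : ℝ} (hq : |q| < 1) : 0 < 1 - q := by
  simpa using one_sub_pow_pos hq one_ne_zero

theorem qFactorial_pos {q : ℝ} (hq : |q| < 1) (n : ℕ) : 0 < qFactorial q n := by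
  have h := qPoch_self_pos hq n
  rw [qPoch_self_eq_qFactorial] at h
  exact pos_of_mul_pos_right h (pow_pos (one_sub_pos_of_abs_lt_one hq) n).le

theorem qBinomial_eq_qPoch {q : ℝ} (hq : |q| < 1) (n k : ℕ) :
    qBinomial q (n + k) k = qPoch q q (n + k) / (qPoch q q n * qPoch q q k) := by
  have h0 := (one_sub_pos_of_abs_lt_one hq).ne'
  have h1 := (qFactorial_pos hq n).ne'
  have h2 := (qFactorial_pos hq k).ne'
  rw [qBinomial, if_pos (Nat.le_add_left k n), Nat.add_sub_cancel]
  simp only [qPoch_self_eq_qFactorial, pow_add]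
  field_simp

/-- The Al-Salam–Chihara density with respect to `measureT`. -/
noncomputable def ascWeight (q s p x : ℝ) : ℝ :=
  qPochInf q q * qPochInf p q / (2 * Real.pi) *
    ∏' k, (hermiteFactor q k x / ascFactor q s p k x)

/-- The Al-Salam–Chihara density. -/
noncomputable def ascDensity (q s p x : ℝ) : ℝ :=
  (Set.Icc (-1 : ℝ) 1).indicator (fun x => qPochInf q q * qPochInf p q / (2 * Real.pi * √(1 - x ^ 2))
    * ∏' k, (hermiteFactor q k x / ascFactor q s p k x)) x

/-- The integral of the `n`-th Chebyshev polynomial of the second kind under the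
Al-Salam–Chihara law. -/
noncomputable def ascMoment (q s p : ℝ) (n : ℕ) : ℝ :=
  ∑ j ∈ Finset.range (n / 2 + 1), (-1) ^ j * q ^ (j * (j + 1) / 2) * qBinomial q (n - j) j *
    (qPoch q q (n - 2 * j) * rsSeq q s p (n - 2 * j))

variable {q s p : ℝ} {a b : ℂ}

theorem ascWeight_eq (hq : |q| < 1) (ha : ‖a‖ < 1) (hb : ‖b‖ < 1) (hs : a + b = s)
    (hp : a * b = p) {x : ℝ} (hx : x ∈ Set.Icc (-1 : ℝ) 1) :
    ascWeight q s p x = hermiteWeight q x * ∑' n, mehlerSeries q s p x n := by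
  have h := qPochInf_mul_tprod_div hq ha hb hs hp hx
  rw [ascWeight, hermiteWeight]
  linear_combination qPochInf q q / (2 * Real.pi) * h

theorem measurable_mehlerSeries (q s p : ℝ) (n : ℕ) :
    Measurable fun x => mehlerSeries q s p x n :=
  ((continuous_rsSeq q 1 n).const_mul _).measurable

theorem aemeasurable_ascWeight (hq : |q| < 1) (ha : ‖a‖ < 1) (hb : ‖b‖ < 1) (hs : a + b = s)
    (hp : a * b = p) {μ : Measure ℝ} (hμ : ∀ᵐ x ∂μ, x ∈ Set.Icc (-1 : ℝ) 1) :
    AEMeasurable (ascWeight q s p) μ := by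
  obtain ⟨B, hB, hB'⟩ := exists_abs_mehlerSeries_le hq ha hb hs hp
  refine aemeasurable_of_tendsto_metrizable_ae Filter.atTop
    (f := fun N x => hermiteWeight q x * ∑ n ∈ Finset.range N, mehlerSeries q s p x n)
    (fun N => ?_) ?_
  · exact ((measurable_hermiteWeight hq).mul
      (Finset.measurable_fun_sum _ fun n _ => measurable_mehlerSeries q s p n)).aemeasurable
  · filter_upwards [hμ] with x hx
    rw [ascWeight_eq hq ha hb hs hp hx]
    exact (hB.of_norm_bounded (hB' x hx)).hasSum.tendsto_sum_nat.const_mul _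

theorem integrable_ascWeight (hq : |q| < 1) (ha : ‖a‖ < 1) (hb : ‖b‖ < 1) (hs : a + b = s)
    (hp : a * b = p) : Integrable (ascWeight q s p) measureT := by
  obtain ⟨B, hB, hB'⟩ := exists_abs_mehlerSeries_le hq ha hb hs hp
  obtain ⟨C, hC⟩ := exists_abs_hermiteWeight_le hq
  refine Integrable.of_bound
    (aemeasurable_ascWeight hq ha hb hs hp ae_measureT_mem_Icc).aestronglyMeasurable
    (C * ∑' n, B n) ?_
  filter_upwards [ae_measureT_mem_Icc] with x hx
  rw [ascWeight_eq hq ha hb hs hp hx, norm_mul]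
  exact mul_le_mul (hC x hx) (tsum_of_norm_bounded hB.hasSum (hB' x hx)) (norm_nonneg _)
    ((abs_nonneg _).trans (hC x hx))

theorem integral_chebU_mul_mehlerSeries (n : ℤ) (k : ℕ) :
    ∫ x, chebU n x * hermiteWeight q x * mehlerSeries q s p x k ∂measureT
      = qPoch q q k * rsSeq q s p k * mixedMoment q n k := by
  rw [mixedMoment, ← integral_const_mul]
  congr 1
  ext x
  rw [mehlerSeries]
  ring

/-- The x-independent majorant of the Mehler series allows termwise integration, and only the terms
k = n - 2j have a nonzero mixed moment. -/
theorem integral_chebU_mul_ascWeight (hq : |q| < 1) (ha : ‖a‖ < 1) (hb : ‖b‖ < 1) (hs : a + b = s)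
    (hp : a * b = p) (n : ℕ) :
    ∫ x, chebU n x * ascWeight q s p x ∂measureT = ascMoment q s p n := by
  obtain ⟨B, hB, hB'⟩ := exists_abs_mehlerSeries_le hq ha hb hs hp
  have hi : Integrable (fun x => chebU n x * hermiteWeight q x) measureT :=
    Integrable.continuous_mul_of_ae_mem_Icc ae_measureT_mem_Icc (continuous_chebU n)
      (integrable_hermiteWeight hq)
  have hbd : ∀ k, ∀ᵐ x ∂measureT, ‖mehlerSeries q s p x k‖ ≤ B k := fun k =>
    ae_measureT_mem_Icc.mono fun x hx => hB' x hx k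
  have hF : ∀ k, Integrable (fun x => chebU n x * hermiteWeight q x * mehlerSeries q s p x k)
      measureT := fun k => hi.mul_bdd (measurable_mehlerSeries q s p k).aestronglyMeasurable (hbd k)
  have h := hasSum_integral_of_summable_integral_norm hF (by
    refine Summable.of_nonneg_of_le (fun k => integral_nonneg fun x => norm_nonneg _) (fun k => ?_)
      (hB.mul_left (∫ x, ‖chebU n x * hermiteWeight q x‖ ∂measureT))
    rw [← integral_mul_const]
    refine integral_mono_ae (hF k).norm (hi.norm.mul_const _) ?_
    filter_upwards [hbd k] with x hx
    rw [norm_mul]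
    exact mul_le_mul_of_nonneg_left hx (norm_nonneg _))
  have hE : ∫ x, chebU n x * ascWeight q s p x ∂measureT =
      ∫ x, ∑' k, chebU n x * hermiteWeight q x * mehlerSeries q s p x k ∂measureT := by
    refine integral_congr_ae ?_
    filter_upwards [ae_measureT_mem_Icc] with x hx
    rw [ascWeight_eq hq ha hb hs hp hx, tsum_mul_left, mul_assoc]
  rw [hE, ← h.tsum_eq]
  simp only [integral_chebU_mul_mehlerSeries]
  have hinj : Set.InjOn (fun j => n - 2 * j) (Finset.range (n / 2 + 1) : Set ℕ) := by
    intro i hi j hj hij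
    simp only [Finset.coe_range, Set.mem_Iio] at hi hj
    simp only at hij
    omega
  rw [tsum_eq_sum (s := (Finset.range (n / 2 + 1)).image fun j => n - 2 * j), Finset.sum_image hinj]
  · refine Finset.sum_congr rfl fun j hj => ?_
    rw [Finset.mem_range] at hj
    obtain ⟨k, rfl⟩ : ∃ k, n = k + 2 * j := ⟨n - 2 * j, by omega⟩
    rw [Nat.add_sub_cancel, (mixedMoment_eq hq k).1 j, show k + 2 * j - j = k + j by omega,
      qBinomial_eq_qPoch hq]
    ring
  · intro k hk
    rw [(mixedMoment_eq hq k).2 n (by omega), mul_zero]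
    intro j hj
    refine hk (Finset.mem_image.2 ⟨j, Finset.mem_range.2 ?_, ?_⟩) <;> omega

theorem qPochInf_nonneg (hq : |q| < 1) {c : ℝ} (hc : |c| < 1) : 0 ≤ qPochInf c q := by
  refine ge_of_tendsto' (tendsto_qPoch hq c) fun N => Finset.prod_nonneg fun k _ => ?_
  have h : |c * q ^ k| ≤ 1 := by
    rw [abs_mul, abs_pow]
    exact mul_le_one₀ hc.le (by positivity) (pow_le_one₀ (abs_nonneg q) hq.le)
  linarith [(abs_le.1 h).2]

/-- Needed because `measureOfDensity` truncates negative values through `ENNReal.ofReal`. The sign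
of the factors is left as a hypothesis since real and conjugate parameters give it for different
reasons. -/
theorem ascWeight_nonneg (hq : |q| < 1) (ha : ‖a‖ < 1) (hb : ‖b‖ < 1) (hs : a + b = s)
    (hp : a * b = p) {x : ℝ} (hx : x ∈ Set.Icc (-1 : ℝ) 1) (hw : ∀ k, 0 ≤ ascFactor q s p k x) :
    0 ≤ ascWeight q s p x := by
  have hp1 : |p| < 1 := by
    rw [← Real.norm_eq_abs, ← Complex.norm_real, ← hp, norm_mul]
    exact (mul_le_of_le_one_right (norm_nonneg a) hb.le).trans_lt ha
  have h0 := (tprod_ascFactor_ne_zero_and_mul_tsum hq ha hb hs hp hx).1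
  refine mul_nonneg (div_nonneg (mul_nonneg (qPochInf_self_pos hq).le (qPochInf_nonneg hq hp1))
    (by positivity)) ?_
  refine ge_of_tendsto' ((multipliable_hermiteFactor hq x).div₀
    (multipliable_ascFactor hq s p x) h0).hasProd.tendsto_prod_nat fun N =>
      Finset.prod_nonneg fun k _ => div_nonneg (hermiteFactor_nonneg hq k hx) (hw k)

/-- The factor 1 / √(1 - x²) is absorbed into `measureT`; the endpoint excluded by `Ioc` is null. -/
theorem measureOfDensity_ascDensity (hq : |q| < 1) (ha : ‖a‖ < 1) (hb : ‖b‖ < 1) (hs : a + b = s)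
    (hp : a * b = p) : measureOfDensity (ascDensity q s p) =
      measureT.withDensity fun x => ENNReal.ofReal (ascWeight q s p x) := by
  have h1 : ∀ x, ENNReal.ofReal (ascDensity q s p x) = (Set.Icc (-1 : ℝ) 1).indicator
      ((fun x => ENNReal.ofReal (√(1 - x ^ 2)⁻¹)) * fun x => ENNReal.ofReal (ascWeight q s p x)) x := by
    intro x
    by_cases hx : x ∈ Set.Icc (-1 : ℝ) 1
    · rw [ascDensity, Set.indicator_of_mem hx, Set.indicator_of_mem hx, Pi.mul_apply,
        ← ENNReal.ofReal_mul (by positivity), ascWeight, Real.sqrt_inv]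
      congr 1
      rw [mul_comm (2 * Real.pi), ← div_div, div_right_comm, div_eq_mul_inv _ √_]
      ring
    · rw [ascDensity, Set.indicator_of_notMem hx, Set.indicator_of_notMem hx, ENNReal.ofReal_zero]
  have hT : measureT = (volume.restrict (Set.Icc (-1 : ℝ) 1)).withDensity
      fun x => ENNReal.ofReal (√(1 - x ^ 2)⁻¹) := by
    rw [measureT, restrict_withDensity measurableSet_Ioc,
      Measure.restrict_congr_set Ioc_ae_eq_Icc]
    congr 1
    ext x
    rw [ENNReal.ofReal_eq_coe_nnreal (by positivity)]
  rw [measureOfDensity]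
  simp only [h1]
  rw [withDensity_indicator measurableSet_Icc, hT, withDensity_mul₀]
  · exact Measurable.aemeasurable (by fun_prop)
  · exact (aemeasurable_ascWeight hq ha hb hs hp (ae_restrict_mem measurableSet_Icc)).ennreal_ofReal

end

/-! ### Powers and exponentials in terms of Chebyshev polynomials -/

/-- The coefficient of `U_{n-2m}` in `(2x)^n`. -/
def ballot (n m : ℕ) : ℝ := (n.choose m : ℝ) - if 0 < m then (n.choose (m - 1) : ℝ) else 0

theorem ballot_zero (n : ℕ) : ballot n 0 = 1 := by simp [ballot]

theorem ballot_succ (n m : ℕ) : ballot n (m + 1) = n.choose (m + 1) - n.choose m := by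
  simp [ballot]

theorem ballot_succ_succ (n m : ℕ) : ballot (n + 1) (m + 1) = ballot n (m + 1) + ballot n m := by
  rcases m with _ | m
  · simp [ballot_zero, ballot_succ]
  · simp only [ballot_succ, Nat.choose_succ_succ]
    push_cast
    ring

theorem two_mul_pow_eq_sum_chebU (x : ℝ) (n : ℕ) :
    (2 * x) ^ n = ∑ m ∈ Finset.range (n / 2 + 1), ballot n m * chebU ((n : ℤ) - 2 * m) x := by
  induction n with
  | zero => simp [ballot_zero]
  | succ n ih =>
    have h1 : (2 * x) ^ (n + 1) =
        ∑ m ∈ Finset.range (n / 2 + 1), ballot n m * chebU ((n : ℤ) + 1 - 2 * m) x +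
        ∑ m ∈ Finset.range (n / 2 + 1), ballot n m * chebU ((n : ℤ) - 1 - 2 * m) x := by
      rw [pow_succ', ih, Finset.mul_sum, ← Finset.sum_add_distrib]
      refine Finset.sum_congr rfl fun m _ => ?_
      have h := two_mul_chebU ((n : ℤ) - 2 * m) x
      rw [sub_add_eq_add_sub, sub_right_comm] at h
      linear_combination ballot n m * h
    have h2 : ∑ m ∈ Finset.range ((n + 1) / 2 + 1),
        ballot (n + 1) m * chebU (((n + 1 : ℕ) : ℤ) - 2 * m) x =
        ∑ m ∈ Finset.range ((n + 1) / 2 + 1), ballot n m * chebU ((n : ℤ) + 1 - 2 * m) x +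
        ∑ m ∈ Finset.range ((n + 1) / 2), ballot n m * chebU ((n : ℤ) - 1 - 2 * m) x := by
      rw [Finset.sum_range_succ', Finset.sum_range_succ' _ ((n + 1) / 2), add_right_comm,
        ← Finset.sum_add_distrib]
      congr 1
      · refine Finset.sum_congr rfl fun m _ => ?_
        rw [ballot_succ_succ, show ((n + 1 : ℕ) : ℤ) - 2 * ((m + 1 : ℕ) : ℤ) = n - 1 - 2 * m by
          push_cast; ring, show (n : ℤ) + 1 - 2 * ((m + 1 : ℕ) : ℤ) = n - 1 - 2 * m by
          push_cast; ring]
        ring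
      · simp [ballot_zero]
    rw [h1, h2]
    -- The two sides differ by one boundary term: for even n it carries U_{-1} = 0, for odd n the
    -- ballot number C(2l+1, l+1) - C(2l+1, l) = 0.
    rcases Nat.even_or_odd' n with ⟨l, rfl | rfl⟩
    · rw [show 2 * l / 2 = l by omega, show (2 * l + 1) / 2 = l by omega,
        Finset.sum_range_succ _ l, Finset.sum_range_succ _ l]
      have : ((2 * l : ℕ) : ℤ) - 1 - 2 * l = -1 := by push_cast; ring
      rw [this, chebU_neg_one]
      ring
    · rw [show (2 * l + 1) / 2 = l by omega, show (2 * l + 1 + 1) / 2 = l + 1 by omega,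
        Finset.sum_range_succ _ (l + 1), ballot_succ, Nat.choose_symm_half]
      ring

section
variable {M : Measure ℝ} [IsFiniteMeasure M]

theorem integrable_of_ae_mem_Icc (hM : ∀ᵐ x ∂M, x ∈ Set.Icc (-1 : ℝ) 1) {f : ℝ → ℝ}
    (hf : Continuous f) : Integrable f M := by
  simpa using Integrable.continuous_mul_of_ae_mem_Icc hM hf (integrable_const (1 : ℝ))

theorem integral_pow_eq_sum (hM : ∀ᵐ x ∂M, x ∈ Set.Icc (-1 : ℝ) 1) (n : ℕ) :
    ∫ x, x ^ n ∂M = 1 / 2 ^ n * ∑ m ∈ Finset.range (n / 2 + 1),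
      ballot n m * ∫ x, chebU ((n - 2 * m : ℕ) : ℤ) x ∂M := by
  have h : ∀ x : ℝ, x ^ n = 1 / 2 ^ n * ∑ m ∈ Finset.range (n / 2 + 1),
      ballot n m * chebU ((n - 2 * m : ℕ) : ℤ) x := fun x => by
    have h1 : ∑ m ∈ Finset.range (n / 2 + 1), ballot n m * chebU ((n - 2 * m : ℕ) : ℤ) x
        = (2 * x) ^ n := by
      rw [two_mul_pow_eq_sum_chebU]
      refine Finset.sum_congr rfl fun m hm => ?_
      rw [Finset.mem_range] at hm
      rw [Nat.cast_sub (by omega)]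
      push_cast
      rfl
    rw [h1, mul_pow]
    field_simp
  rw [show (fun x : ℝ => x ^ n) = fun x => 1 / 2 ^ n * ∑ m ∈ Finset.range (n / 2 + 1),
      ballot n m * chebU ((n - 2 * m : ℕ) : ℤ) x from funext h, integral_const_mul,
    integral_finsetSum]
  · simp only [integral_const_mul]
  · exact fun m _ => (integrable_of_ae_mem_Icc hM (continuous_chebU _)).const_mul _

theorem hasSum_integral_exp (hM : ∀ᵐ x ∂M, x ∈ Set.Icc (-1 : ℝ) 1) (t : ℝ) :
    HasSum (fun n : ℕ => t ^ n / n.factorial * ∫ x, x ^ n ∂M) (∫ x, Real.exp (t * x) ∂M) := by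
  have hb : ∀ n : ℕ, ∀ᵐ x ∂M, ‖t ^ n / n.factorial * x ^ n‖ ≤ |t| ^ n / n.factorial := fun n => by
    filter_upwards [hM] with x hx
    rw [norm_mul, norm_div, norm_pow, norm_pow, Real.norm_natCast]
    exact mul_le_of_le_one_right (by positivity)
      (pow_le_one₀ (norm_nonneg x) (abs_le.2 ⟨hx.1, hx.2⟩))
  have h := hasSum_integral_of_dominated_convergence (μ := M)
    (F := fun (n : ℕ) x => t ^ n / n.factorial * x ^ n) (f := fun x => Real.exp (t * x))
    (fun n _ => |t| ^ n / n.factorial)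
    (fun n => by fun_prop) hb
    (Filter.Eventually.of_forall fun x => Real.summable_pow_div_factorial |t|)
    (integrable_const _) (Filter.Eventually.of_forall fun x => by
      have := NormedSpace.expSeries_div_hasSum_exp (t * x)
      rw [← Real.exp_eq_exp_ℝ] at this
      exact this.congr_fun fun n => by rw [mul_pow]; ring)
  simpa only [integral_const_mul] using h

theorem abs_integral_chebU_le (hM : ∀ᵐ x ∂M, x ∈ Set.Icc (-1 : ℝ) 1) (n : ℕ) :
    |∫ x, chebU n x ∂M| ≤ (n + 1) * M.real Set.univ := by
  rw [← Real.norm_eq_abs]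
  exact norm_integral_le_of_norm_le_const (hM.mono fun _ hx => abs_chebU_le n hx)

end

/-! ### Rearrangement of double series along `n = k + 2 j` -/

theorem HasSum.sum_range_half {F : ℕ × ℕ → ℝ} {A : ℝ} (h : HasSum F A) :
    HasSum (fun n => ∑ j ∈ Finset.range (n / 2 + 1), F (n - 2 * j, j)) A := by
  have h1 := h.tsum_fiberwise fun p : ℕ × ℕ => p.1 + 2 * p.2
  convert! h1 using 1
  ext n
  have hs : (fun p : ℕ × ℕ => p.1 + 2 * p.2) ⁻¹' {n} =
      ((Finset.range (n / 2 + 1)).image fun j => (n - 2 * j, j) : Finset (ℕ × ℕ)) := by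
    ext ⟨k, j⟩
    simp only [Set.mem_preimage, Set.mem_singleton_iff, Finset.coe_image, Set.mem_image,
      Finset.coe_range, Set.mem_Iio, Prod.mk.injEq]
    constructor
    · intro hkj
      exact ⟨j, by omega, by omega, rfl⟩
    · rintro ⟨i, hi, hk, rfl⟩
      omega
  rw [hs, Finset.tsum_subtype' _ F, Finset.sum_image]
  intro i _ j _ hij
  simpa using congrArg Prod.snd hij

/-! ### Modified Bessel functions -/

theorem hasSum_exp (x : ℝ) : HasSum (fun m : ℕ => x ^ m / m.factorial) (Real.exp x) := by
  rw [Real.exp_eq_exp_ℝ]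
  exact NormedSpace.expSeries_div_hasSum_exp x

theorem abs_besselI_term_le (ν : ℕ) (x : ℝ) (m : ℕ) :
    ‖(x / 2) ^ (2 * m + ν) / ((m.factorial : ℝ) * ((m + ν).factorial : ℝ))‖ ≤
      |x / 2| ^ ν / ν.factorial * (((x / 2) ^ 2) ^ m / m.factorial) := by
  have h1 : (ν.factorial : ℝ) ≤ (m + ν).factorial := by
    exact_mod_cast Nat.factorial_le (Nat.le_add_left ν m)
  rw [norm_div, norm_pow, Real.norm_eq_abs, norm_mul, Real.norm_natCast, Real.norm_natCast, pow_add,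
    pow_mul, sq_abs, div_mul_div_comm, mul_comm (|x / 2| ^ ν), mul_comm (ν.factorial : ℝ)]
  gcongr

theorem summable_besselI (ν : ℕ) (x : ℝ) : Summable fun m : ℕ =>
    (x / 2) ^ (2 * m + ν) / ((m.factorial : ℝ) * ((m + ν).factorial : ℝ)) :=
  ((Real.summable_pow_div_factorial _).mul_left _).of_norm_bounded (abs_besselI_term_le ν x)

theorem abs_besselI_le (ν : ℕ) (x : ℝ) :
    |besselI ν x| ≤ |x / 2| ^ ν / ν.factorial * Real.exp ((x / 2) ^ 2) :=
  tsum_of_norm_bounded ((hasSum_exp _).mul_left _) (abs_besselI_term_le ν x)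

/-- The source of the Bessel functions: the right side is ν + 1 times the coefficient of
(t/2)^(2m+ν+1) in I_{ν+1}(t). -/
theorem ballot_div_factorial (ν m : ℕ) : ballot (ν + 2 * m) m / (ν + 2 * m).factorial =
    (ν + 1) / (m.factorial * (m + (ν + 1)).factorial) := by
  rcases m with _ | m
  · have := Nat.factorial_ne_zero ν
    simp only [mul_zero, add_zero, ballot_zero, zero_add, Nat.factorial_succ, Nat.factorial_zero]
    push_cast
    field_simp
  · have h1 := Nat.cast_add_choose ℝ (a := m + 1) (b := ν + m + 1)
    have h2 := Nat.cast_add_choose ℝ (a := m) (b := ν + m + 2)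
    rw [show m + 1 + (ν + m + 1) = ν + 2 * (m + 1) by ring] at h1
    rw [show m + (ν + m + 2) = ν + 2 * (m + 1) by ring] at h2
    rw [ballot_succ, h1, h2, show m + 1 + (ν + 1) = ν + m + 2 by ring,
      Nat.factorial_succ m, Nat.factorial_succ (ν + m + 1)]
    have := Nat.factorial_ne_zero (ν + 2 * (m + 1))
    have := Nat.factorial_ne_zero m
    have := Nat.factorial_ne_zero (ν + m + 1)
    push_cast
    field_simp
    ring

theorem succ_le_two_pow (n : ℕ) : (n : ℝ) + 1 ≤ 2 ^ n := by
  exact_mod_cast Nat.lt_two_pow_self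

/-- Integrated form of e^{tx} = (2/t) ∑ (ν+1) I_{ν+1}(t) U_ν(x), with `u` the Chebyshev moments and
`m` the power moments. One absolutely convergent double family is summed by rows and along n = ν +
2j. -/
theorem hasSum_besselI_mul {u m : ℕ → ℝ} {K t E : ℝ} (ht : t ≠ 0) (hu : ∀ n, |u n| ≤ (n + 1) * K)
    (hm : ∀ n, m n = 1 / 2 ^ n * ∑ j ∈ Finset.range (n / 2 + 1), ballot n j * u (n - 2 * j))
    (hE : HasSum (fun n : ℕ => t ^ n / n.factorial * m n) E) :
    HasSum (fun ν : ℕ => (ν + 1) * besselI (ν + 1) t * u ν) (t / 2 * E) := by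
  have hK : 0 ≤ K := by simpa using (abs_nonneg _).trans (hu 0)
  let F : ℕ × ℕ → ℝ := fun p => (p.1 + 1) * u p.1 *
    ((t / 2) ^ (2 * p.2 + (p.1 + 1)) / ((p.2.factorial : ℝ) * ((p.2 + (p.1 + 1)).factorial : ℝ)))
  have hF : Summable F := by
    have h1 := ((Real.summable_pow_div_factorial (4 * |t / 2|)).mul_left (K * |t / 2|)).mul_of_nonneg
      (Real.summable_pow_div_factorial ((t / 2) ^ 2)) (fun n => by positivity)
      (fun n => by positivity)
    refine h1.of_norm_bounded fun ⟨ν, j⟩ => ?_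
    simp only [F]
    rw [norm_mul, norm_mul, Real.norm_eq_abs, Real.norm_eq_abs, abs_of_nonneg (by positivity)]
    have h2 : ((ν : ℝ) + 1) * |u ν| ≤ 4 ^ ν * K := by
      have h3 := succ_le_two_pow ν
      calc ((ν : ℝ) + 1) * |u ν| ≤ 2 ^ ν * (2 ^ ν * K) :=
            mul_le_mul h3 ((hu ν).trans (mul_le_mul_of_nonneg_right h3 hK)) (abs_nonneg _)
              (by positivity)
        _ = 4 ^ ν * K := by rw [← mul_assoc, ← mul_pow]; norm_num
    have h4 : |t / 2| ^ (ν + 1) / (ν + 1).factorial ≤ |t / 2| ^ (ν + 1) / ν.factorial := by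
      have : (ν.factorial : ℝ) ≤ (ν + 1).factorial := by
        exact_mod_cast Nat.factorial_le (Nat.le_succ ν)
      gcongr
    calc _ ≤ 4 ^ ν * K * (|t / 2| ^ (ν + 1) / ν.factorial * (((t / 2) ^ 2) ^ j / j.factorial)) :=
          mul_le_mul h2 ((abs_besselI_term_le (ν + 1) t j).trans
            (mul_le_mul_of_nonneg_right h4 (by positivity))) (norm_nonneg _) (by positivity)
      _ = _ := by rw [mul_pow]; ring
  have h1 : HasSum (fun ν : ℕ => (ν + 1) * besselI (ν + 1) t * u ν) (∑' p, F p) :=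
    hF.hasSum.prod_fiberwise fun ν => by
      have := (summable_besselI (ν + 1) t).hasSum.mul_left ((ν + 1) * u ν)
      rw [mul_right_comm] at this
      exact this
  have h2 := hF.hasSum.sum_range_half
  have h3 := (hE.mul_left (t / 2)).unique (a₂ := ∑' p, F p) (by
    convert! h2 using 1
    ext n
    rw [hm, Finset.mul_sum, Finset.mul_sum, Finset.mul_sum]
    refine Finset.sum_congr rfl fun j hj => ?_
    rw [Finset.mem_range] at hj
    obtain ⟨ν, rfl⟩ : ∃ ν, n = ν + 2 * j := ⟨n - 2 * j, by omega⟩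
    have hb := ballot_div_factorial ν j
    simp only [F, Nat.add_sub_cancel]
    have e1 : t ^ (ν + 2 * j) * (1 / 2 ^ (ν + 2 * j)) = (t / 2) ^ (ν + 2 * j) := by
      rw [div_pow]; ring
    rw [show 2 * j + (ν + 1) = ν + 2 * j + 1 by ring, pow_succ (t / 2)]
    calc _ = (t / 2) * (t ^ (ν + 2 * j) * (1 / 2 ^ (ν + 2 * j))) *
          (ballot (ν + 2 * j) j / (ν + 2 * j).factorial) * u ν := by ring
      _ = _ := by rw [e1, hb]; ring)
  rwa [h3]

/-! ### Moments and moment generating function of the Al-Salam–Chihara law -/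

section
open Polynomial.Chebyshev
variable {q s p : ℝ} {a b : ℂ}

/-- The degree drops by 2m in the power expansion and by 2j in the Chebyshev moment; grouping by the
total drop m + j produces `qCoeff`. -/
theorem sum_ballot_mul_ascMoment (q s p : ℝ) (n : ℕ) :
    ∑ m ∈ Finset.range (n / 2 + 1), ballot n m * ascMoment q s p (n - 2 * m) =
      ∑ m ∈ Finset.range (n / 2 + 1),
        qCoeff m n q * (qPoch q q (n - 2 * m) * rsSeq q s p (n - 2 * m)) := by
  simp only [ascMoment, qCoeff, Finset.mul_sum, Finset.sum_mul]
  rw [Finset.sum_sigma', Finset.sum_sigma']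
  refine Finset.sum_nbij' (fun x => ⟨x.1 + x.2, x.2⟩) (fun x => ⟨x.1 - x.2, x.2⟩) ?_ ?_ ?_ ?_ ?_
  · rintro ⟨m, j⟩ h
    simp only [Finset.mem_sigma, Finset.mem_range] at h ⊢
    omega
  · rintro ⟨m, j⟩ h
    simp only [Finset.mem_sigma, Finset.mem_range] at h ⊢
    omega
  · rintro ⟨m, j⟩ h
    simp
  · rintro ⟨m, j⟩ h
    simp only [Finset.mem_sigma, Finset.mem_range] at h
    simp only [Sigma.mk.injEq, heq_eq_eq, and_true]
    omega
  · rintro ⟨m, j⟩ h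
    simp only [Finset.mem_sigma, Finset.mem_range] at h
    simp only [Nat.add_sub_cancel, ballot]
    rw [show n - 2 * m - j = n - 2 * (m + j) + j by omega,
      show n - 2 * m - 2 * j = n - 2 * (m + j) by omega]
    simp only [lt_add_iff_pos_left]
    ring

theorem exists_abs_rsSeq_le (hq : |q| < 1) (ha : ‖a‖ < 1) (hb : ‖b‖ < 1) (hs : a + b = s)
    (hp : a * b = p) : ∃ C, 0 ≤ C ∧ ∀ n, |rsSeq q s p n| ≤ C * (n + 1) := by
  obtain ⟨C, hC1, hC⟩ := exists_norm_rogersSzego_le hq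
  refine ⟨C, by linarith, fun n => ?_⟩
  rw [← Real.norm_eq_abs, ← Complex.norm_real, ofReal_rsSeq hq hs hp]
  simpa using hC a b 1 ha.le hb.le n

/-- The estimate (2j+k+1)! ≥ k! j! separates the variables, leaving a product of two
exponential-series terms. -/
theorem exists_abs_innerQ_le (hq : |q| < 1) (t : ℝ) : ∃ D, 0 ≤ D ∧ ∀ k j : ℕ,
    |innerQ q t k j| ≤ D * ((2 * |t / 2|) ^ k / k.factorial) *
      ((4 * (t / 2) ^ 2) ^ j / j.factorial) := by
  obtain ⟨C, hC1, hC⟩ := exists_qPoch_self_le hq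
  obtain ⟨C', hC1', hC'⟩ := exists_inv_qPoch_self_le hq
  refine ⟨C * C' * |t / 2| * Real.exp ((t / 2) ^ 2), by positivity, fun k j => ?_⟩
  have h1 : |(-1 : ℝ) ^ j| = 1 := by simp
  have h2 : |q ^ (j * (j + 1) / 2)| ≤ 1 := by
    rw [abs_pow]; exact pow_le_one₀ (abs_nonneg q) hq.le
  have h3 : |qPoch q q (k + j) * ((k : ℝ) + 2 * j + 1) / qPoch q q j| ≤ C * (2 ^ k * 4 ^ j) * C' := by
    have h4 : (k : ℝ) + 2 * j + 1 ≤ 2 ^ k * 4 ^ j := by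
      have h5 : ((k + 2 * j : ℕ) : ℝ) + 1 ≤ 2 ^ (k + 2 * j) := succ_le_two_pow _
      rw [pow_add, pow_mul] at h5
      push_cast at h5
      norm_num at h5
      exact h5
    rw [abs_of_nonneg (div_nonneg (mul_nonneg (qPoch_self_pos hq _).le (by positivity))
      (qPoch_self_pos hq _).le), div_eq_mul_inv]
    exact mul_le_mul (mul_le_mul (hC _) h4 (by positivity) (by linarith)) (hC' j)
      (inv_nonneg.2 (qPoch_self_pos hq j).le) (by positivity)
  have h6 : |t / 2| ^ (2 * j + k + 1) / (2 * j + k + 1).factorial ≤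
      |t / 2| ^ (2 * j + k + 1) / (k.factorial * j.factorial) := by
    have h7 : k.factorial * j.factorial ≤ (2 * j + k + 1).factorial :=
      (Nat.le_of_dvd (Nat.factorial_pos _) (Nat.factorial_mul_factorial_dvd_factorial_add k j)).trans
        (Nat.factorial_le (by omega))
    have h8 : (k.factorial : ℝ) * j.factorial ≤ (2 * j + k + 1).factorial := by exact_mod_cast h7
    gcongr
  have h9 := (abs_besselI_le (2 * j + k + 1) t).trans
    (mul_le_mul_of_nonneg_right h6 (Real.exp_pos _).le)
  rw [innerQ, abs_mul, abs_mul, abs_mul, h1, one_mul]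
  calc _ ≤ C * (2 ^ k * 4 ^ j) * C' * 1 * (|t / 2| ^ (2 * j + k + 1) /
        (k.factorial * j.factorial) * Real.exp ((t / 2) ^ 2)) :=
        mul_le_mul (mul_le_mul h3 h2 (abs_nonneg _) (by positivity)) h9 (abs_nonneg _)
          (by positivity)
    _ = _ := by
        rw [mul_pow, mul_pow, ← sq_abs, pow_succ, pow_add, pow_mul]
        field_simp

theorem summable_innerQ (hq : |q| < 1) (t : ℝ) (k : ℕ) : Summable (innerQ q t k) := by
  obtain ⟨D, -, hD⟩ := exists_abs_innerQ_le hq t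
  exact ((Real.summable_pow_div_factorial _).mul_left _).of_norm_bounded (hD k)

/-- Substituting the finite sum for each Chebyshev moment and regrouping by k = n - 2j gives the
inner series; (q)_k cancels the denominator of the q-binomial. -/
theorem hasSum_rsSeq_mul_tsum_innerQ (hq : |q| < 1) (ha : ‖a‖ < 1) (hb : ‖b‖ < 1) (hs : a + b = s)
    (hp : a * b = p) {t A : ℝ}
    (hA : HasSum (fun n : ℕ => (n + 1) * besselI (n + 1) t * ascMoment q s p n) A) :
    HasSum (fun k => rsSeq q s p k * ∑' j, innerQ q t k j) A := by
  obtain ⟨D, hD0, hD⟩ := exists_abs_innerQ_le hq t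
  obtain ⟨C, hC0, hC⟩ := exists_abs_rsSeq_le hq ha hb hs hp
  let G : ℕ × ℕ → ℝ := fun x => rsSeq q s p x.1 * innerQ q t x.1 x.2
  have hG : Summable G := by
    have h1 := ((Real.summable_pow_div_factorial (4 * |t / 2|)).mul_left (C * D)).mul_of_nonneg
      (Real.summable_pow_div_factorial (4 * (t / 2) ^ 2)) (fun n => by positivity)
      (fun n => by positivity)
    refine h1.of_norm_bounded fun ⟨k, j⟩ => ?_
    have h2 : |rsSeq q s p k| ≤ C * 2 ^ k :=
      (hC k).trans (mul_le_mul_of_nonneg_left (succ_le_two_pow k) hC0)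
    simp only [G]
    rw [norm_mul, Real.norm_eq_abs, Real.norm_eq_abs]
    calc _ ≤ C * 2 ^ k * (D * ((2 * |t / 2|) ^ k / k.factorial) *
          ((4 * (t / 2) ^ 2) ^ j / j.factorial)) :=
          mul_le_mul h2 (hD k j) (abs_nonneg _) (by positivity)
      _ = _ := by
          rw [show (4 : ℝ) * |t / 2| = 2 * (2 * |t / 2|) by ring, mul_pow 2 (2 * |t / 2|)]
          ring
  have h1 := hG.hasSum.prod_fiberwise fun k => (summable_innerQ hq t k).hasSum.mul_left (rsSeq q s p k)
  have h2 := hG.hasSum.sum_range_half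
  rwa [hA.unique (a₂ := ∑' x, G x)]
  convert! h2 using 1
  ext n
  rw [ascMoment, Finset.mul_sum]
  refine Finset.sum_congr rfl fun j hj => ?_
  rw [Finset.mem_range] at hj
  obtain ⟨k, rfl⟩ : ∃ k, n = k + 2 * j := ⟨n - 2 * j, by omega⟩
  simp only [G, innerQ, Nat.add_sub_cancel]
  rw [show k + 2 * j - j = k + j by omega, qBinomial_eq_qPoch hq,
    show k + 2 * j + 1 = 2 * j + k + 1 by ring]
  have h3 := (qPoch_self_pos hq k).ne'
  push_cast
  field_simp

/-- Bounded support and finiteness of the law suffice; its total mass need not be computed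
beforehand. -/
theorem ascLaw {Ω : Type*} [MeasurableSpace Ω] {P : Measure Ω} {X : Ω → ℝ} (hq : |q| < 1)
    (ha : ‖a‖ < 1) (hb : ‖b‖ < 1) (hs : a + b = s) (hp : a * b = p)
    (hw : ∀ x ∈ Set.Icc (-1 : ℝ) 1, ∀ k, 0 ≤ ascFactor q s p k x)
    (hX : HasLaw X (measureOfDensity (ascDensity q s p)) P) :
    (∀ n : ℕ, Integrable (fun ω => X ω ^ n) P ∧
      ∫ ω, X ω ^ n ∂P = 1 / 2 ^ n * ∑ j ∈ Finset.range (n / 2 + 1),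
        qCoeff j n q * (qPoch q q (n - 2 * j) * rsSeq q s p (n - 2 * j))) ∧
    (∀ t : ℝ, t ≠ 0 → Integrable (fun ω => Real.exp (t * X ω)) P ∧
      HasSum (fun k => rsSeq q s p k * ∑' j, innerQ q t k j) (t / 2 * mgf X P t)) := by
  rw [measureOfDensity_ascDensity hq ha hb hs hp] at hX
  have hg := aemeasurable_ascWeight hq ha hb hs hp ae_measureT_mem_Icc
  have hint := integrable_ascWeight hq ha hb hs hp
  set M := measureT.withDensity fun x => ENNReal.ofReal (ascWeight q s p x) with hMdef
  have hfin : IsFiniteMeasure M := isFiniteMeasure_withDensity_ofReal hint.2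
  have hM : ∀ᵐ x ∂M, x ∈ Set.Icc (-1 : ℝ) 1 :=
    (withDensity_absolutelyContinuous _ _).ae_le ae_measureT_mem_Icc
  have hu : ∀ n : ℕ, ∫ x, chebU n x ∂M = ascMoment q s p n := fun n => by
    rw [hMdef, integral_withDensity_eq_integral_toReal_smul₀ hg.ennreal_ofReal (by simp),
      ← integral_chebU_mul_ascWeight hq ha hb hs hp n]
    refine integral_congr_ae ?_
    filter_upwards [ae_measureT_mem_Icc] with x hx
    rw [ENNReal.toReal_ofReal (ascWeight_nonneg hq ha hb hs hp hx (hw x hx)), smul_eq_mul, mul_comm]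
  have hI : ∀ {f : ℝ → ℝ}, Continuous f → Integrable (fun ω => f (X ω)) P ∧
      ∫ ω, f (X ω) ∂P = ∫ x, f x ∂M := fun {f} hf => by
    have h := integrable_of_ae_mem_Icc hM hf
    refine ⟨?_, hX.integral_comp h.1⟩
    rw [← hX.map_eq] at h
    exact h.comp_aemeasurable hX.aemeasurable
  have hpow := integral_pow_eq_sum hM
  simp only [hu] at hpow
  refine ⟨fun n => ?_, fun t ht => ?_⟩
  · obtain ⟨h1, h2⟩ := hI (continuous_pow n)
    exact ⟨h1, by rw [h2, hpow, sum_ballot_mul_ascMoment]⟩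
  · obtain ⟨h1, h2⟩ := hI (f := fun x => Real.exp (t * x)) (by fun_prop)
    refine ⟨h1, hasSum_rsSeq_mul_tsum_innerQ hq ha hb hs hp ?_⟩
    rw [mgf, h2]
    exact hasSum_besselI_mul ht (fun n => hu n ▸ abs_integral_chebU_le hM n) hpow
      (hasSum_integral_exp hM t)

/-! ### Real parameters -/

theorem qS_eq_qPoch_mul_rsSeq (hq : |q| < 1) (a b : ℝ) (n : ℕ) :
    qS n a b q = qPoch q q n * rsSeq q (a + b) (a * b) n := by
  apply Complex.ofReal_injective
  rw [Complex.ofReal_mul, ofReal_rsSeq hq (a := a) (b := b) (by simp) (by simp), rogersSzego,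
    Finset.Nat.sum_antidiagonal_eq_sum_range_succ_mk, qS, Complex.ofReal_sum, Finset.mul_sum]
  refine Finset.sum_congr rfl fun i hi => ?_
  obtain ⟨j, rfl⟩ : ∃ j, n = j + i := ⟨n - i, by rw [Finset.mem_range] at hi; omega⟩
  rw [qBinomial_eq_qPoch hq, Nat.add_sub_cancel]
  push_cast
  ring

theorem smallW_eq_ascFactor (k : ℕ) (x a b q : ℝ) :
    smallW k x a b q = ascFactor q (a + b) (a * b) k x := by
  rw [smallW, ascFactor, mul_comm 2 k, mul_comm 4 k, pow_mul, pow_mul]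
  ring

/-- For real parameters the factor is |1 - a e^{iθ} q^k|² |1 - b e^{iθ} q^k|², with x = cos θ. -/
theorem smallW_nonneg (k : ℕ) {x : ℝ} (hx : x ∈ Set.Icc (-1 : ℝ) 1) (a b q : ℝ) :
    0 ≤ smallW k x a b q := by
  have hx2 : 0 ≤ 1 - x ^ 2 := by nlinarith [hx.1, hx.2]
  have h : ∀ c : ℝ, 0 ≤ (1 - x * c * q ^ k) ^ 2 + (c * q ^ k) ^ 2 * (1 - x ^ 2) := fun c => by
    positivity
  refine (mul_nonneg (h a) (h b)).trans_eq ?_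
  rw [smallW, mul_comm 2 k, pow_mul]
  ring

theorem densityQ_eq_ascDensity (a b q : ℝ) : densityQ a b q = ascDensity q (a + b) (a * b) := by
  ext x
  simp only [densityQ, ascDensity, smallW_eq_ascFactor, hermiteFactor]

/-! ### Conjugate parameters -/

theorem qPoch_mul_rsSeq_eq_qHermite (hq : |q| < 1) (ρ y : ℝ) (n : ℕ) :
    qPoch q q n * rsSeq q (ρ * (√(1 - q) * y)) (ρ ^ 2) n = √(1 - q) ^ n * ρ ^ n * qHermite q n y := by
  have hr : √(1 - q) ^ 2 = 1 - q := Real.sq_sqrt (one_sub_pos_of_abs_lt_one hq).le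
  induction n using Nat.twoStepInduction with
  | zero => simp [qPoch, rsSeq, qHermite]
  | one =>
    have h := rsSeq_one hq (ρ * (√(1 - q) * y)) (ρ ^ 2)
    have h1 : qPoch q q 1 = 1 - q := by simp [qPoch]
    rw [h1, h, qHermite]
    ring
  | more n h0 h1 =>
    have h := rsSeq_add_two hq (ρ * (√(1 - q) * y)) (ρ ^ 2) n
    have h2 := one_sub_mul_qNumber q (n + 1)
    rw [qHermite, qPoch_self_succ q (n + 1)]
    have h3 := qPoch_self_succ q n
    linear_combination qPoch q q (n + 1) * h + ρ * √(1 - q) * y * h1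
      - ρ ^ 2 * (1 - q ^ (n + 1)) * h0 - ρ ^ 2 * rsSeq q (ρ * (√(1 - q) * y)) (ρ ^ 2) n * h3
      + √(1 - q) ^ n * ρ ^ (n + 2) * qHermite q n y * (h2 + qNumber q (n + 1) * hr)

theorem bigW_eq_ascFactor (hq : |q| < 1) (k : ℕ) (x y ρ : ℝ) :
    bigW k x y ρ q = ascFactor q (ρ * (√(1 - q) * y)) (ρ ^ 2) k (√(1 - q) / 2 * x) := by
  have hr : √(1 - q) ^ 2 = 1 - q := Real.sq_sqrt (one_sub_pos_of_abs_lt_one hq).le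
  rw [bigW, ascFactor, mul_comm 2 k, mul_comm 4 k, pow_mul, pow_mul]
  linear_combination (ρ * q ^ k * (1 + ρ ^ 2 * (q ^ k) ^ 2) * x * y
    - ρ ^ 2 * (x ^ 2 + y ^ 2) * (q ^ k) ^ 2) * hr

/-- The point √(1-q) y / 2 of [-1, 1] is cos φ, and the parameters are ρ e^{±iφ}. -/
theorem exists_conj_params {ρ y : ℝ} (hq : |q| < 1) (hρ : |ρ| < 1) (hy : y ∈ qInterval q) :
    ∃ a b : ℂ, ‖a‖ < 1 ∧ ‖b‖ < 1 ∧ a + b = ((ρ * (√(1 - q) * y) : ℝ) : ℂ) ∧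
      a * b = ((ρ ^ 2 : ℝ) : ℂ) ∧ b = starRingEnd ℂ a := by
  have hr : 0 < √(1 - q) := Real.sqrt_pos.2 (one_sub_pos_of_abs_lt_one hq)
  have hx : √(1 - q) * y / 2 ∈ Set.Icc (-1 : ℝ) 1 := by
    obtain ⟨h1, h2⟩ := hy
    rw [← neg_div, div_le_iff₀ hr] at h1
    rw [le_div_iff₀ hr] at h2
    constructor <;> linarith
  obtain ⟨z, w, hz, hw, hzw, hzw1, hc⟩ := exists_unit_add_inv hx
  have hlt : ∀ v : ℂ, ‖v‖ ≤ 1 → ‖(ρ : ℂ) * v‖ < 1 := fun v hv => by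
    rw [norm_mul, Complex.norm_real]
    exact (mul_le_of_le_one_right (norm_nonneg ρ) hv).trans_lt hρ
  push_cast at hzw hzw1
  refine ⟨ρ * z, ρ * w, hlt z hz, hlt w hw, ?_, ?_, ?_⟩
  · push_cast
    linear_combination (ρ : ℂ) * hzw
  · push_cast
    linear_combination (ρ : ℂ) ^ 2 * hzw1
  · rw [map_mul, Complex.conj_ofReal, hc]

/-- With conjugate parameters, 1 - a z q^k is conjugate to 1 - b w q^k and 1 - a w q^k to 1 - b z
q^k, so the four linear factors pair into two squared moduli. -/
theorem ascFactor_nonneg_of_conj (hs : a + b = s) (hp : a * b = p) (hab : b = starRingEnd ℂ a)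
    {x : ℝ} (hx : x ∈ Set.Icc (-1 : ℝ) 1) (k : ℕ) : 0 ≤ ascFactor q s p k x := by
  obtain ⟨z, w, -, -, hzw, hzw1, hc⟩ := exists_unit_add_inv hx
  have h : ascFactor q s p k x = Complex.normSq (1 - a * z * (q : ℂ) ^ k) *
      Complex.normSq (1 - a * w * (q : ℂ) ^ k) := by
    apply Complex.ofReal_injective
    rw [ofReal_ascFactor hs hp hzw hzw1, Complex.ofReal_mul, ← Complex.mul_conj,
      ← Complex.mul_conj]
    simp only [map_sub, map_one, map_mul, map_pow, Complex.conj_ofReal, hab, hc, Complex.conj_conj]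
    ring
  rw [h]
  exact mul_nonneg (Complex.normSq_nonneg _) (Complex.normSq_nonneg _)

/-- The numerators 1 - ρ² q^k assemble into (p)_∞ with p = ρ²; the prefactor √(1-q) / 2 is the
Jacobian of the rescaling. -/
theorem densityCN_eq_ascDensity {ρ y : ℝ} (hq : |q| < 1) (hρ : |ρ| < 1) (hy : y ∈ qInterval q)
    (x : ℝ) : densityCN y ρ q x = √(1 - q) / 2 *
      ascDensity q (ρ * (√(1 - q) * y)) (ρ ^ 2) (√(1 - q) / 2 * x) := by
  obtain ⟨a, b, ha, hb, hs, hp, -⟩ := exists_conj_params hq hρ hy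
  have hr : 0 < √(1 - q) := Real.sqrt_pos.2 (one_sub_pos_of_abs_lt_one hq)
  have hr2 : √(1 - q) ^ 2 = 1 - q := Real.sq_sqrt (one_sub_pos_of_abs_lt_one hq).le
  have hmem : x ∈ qInterval q ↔ √(1 - q) / 2 * x ∈ Set.Icc (-1 : ℝ) 1 := by
    simp only [qInterval, Set.mem_Icc, ← neg_div, div_le_iff₀ hr, le_div_iff₀ hr]
    constructor <;> rintro ⟨h1, h2⟩ <;> constructor <;> linarith
  rw [densityCN, densityN, ascDensity]
  by_cases hx : x ∈ qInterval q
  · have hu := hmem.1 hx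
    set u := √(1 - q) / 2 * x with hudef
    rw [Set.indicator_of_mem hx, Set.indicator_of_mem hu]
    have h0 := (tprod_ascFactor_ne_zero_and_mul_tsum hq ha hb hs hp hu).1
    have hsq : √(4 - (1 - q) * x ^ 2) = 2 * √(1 - u ^ 2) := by
      rw [show 4 - (1 - q) * x ^ 2 = 2 ^ 2 * (1 - u ^ 2) by
          rw [hudef]; linear_combination x ^ 2 * hr2,
        Real.sqrt_mul (by norm_num), Real.sqrt_sq (by norm_num)]
    have hh : ∀ k : ℕ, (1 + q ^ k) ^ 2 - (1 - q) * x ^ 2 * q ^ k = hermiteFactor q k u := fun k => by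
      
      rw [hermiteFactor, hudef]; linear_combination q ^ k * x ^ 2 * hr2
    simp only [hh, bigW_eq_ascFactor hq, ← hudef]
    rw [(multipliable_hermiteFactor hq u).tprod_div₀ (multipliable_ascFactor hq _ _ u) h0,
      (multipliable_qPochInf hq (ρ ^ 2)).tprod_div₀ (multipliable_ascFactor hq _ _ u) h0, hsq,
      qPochInf, qPochInf]
    rw [← mul_assoc (2 * Real.pi) 2, mul_right_comm (2 * Real.pi) 2, ← div_div]
    ring
  · rw [Set.indicator_of_notMem hx, Set.indicator_of_notMem (mt hmem.2 hx)]
    simp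

theorem HasLaw.const_mul_of_density {Ω : Type*} [MeasurableSpace Ω] {P : Measure Ω} {X : Ω → ℝ}
    {f g : ℝ → ℝ} {c : ℝ} (hc : 0 < c) (hfg : ∀ x, f x = c * g (c * x))
    (hX : HasLaw X (measureOfDensity f) P) : HasLaw (fun ω => c * X ω) (measureOfDensity g) P := by
  refine ⟨hX.aemeasurable.const_mul c, ?_⟩
  have hm : Measurable fun x : ℝ => c * x := measurable_const_mul c
  rw [← Function.comp_def (fun x => c * x), ← AEMeasurable.map_map_of_aemeasurable hm.aemeasurable
    hX.aemeasurable, hX.map_eq]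
  ext A hA
  let e : ℝ ≃ᵐ ℝ := (Homeomorph.mulLeft₀ c hc.ne').toMeasurableEquiv
  have he : Measure.map e volume = ENNReal.ofReal |c⁻¹| • volume := Real.map_volume_mul_left hc.ne'
  have h1 := lintegral_map_equiv (μ := volume) (A.indicator fun x => ENNReal.ofReal (g x)) e
  rw [he, lintegral_smul_measure, smul_eq_mul, lintegral_indicator hA] at h1
  rw [Measure.map_apply hm hA, measureOfDensity, measureOfDensity, withDensity_apply _ (hm hA),
    withDensity_apply _ hA, ← lintegral_indicator (hm hA)]
  have h2 : ∀ x, ((fun x => c * x) ⁻¹' A).indicator (fun x => ENNReal.ofReal (f x)) x =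
      ENNReal.ofReal c * A.indicator (fun x => ENNReal.ofReal (g x)) (e x) := fun x => by
    have hex : e x = c * x := rfl
    by_cases hx : c * x ∈ A
    · rw [Set.indicator_of_mem (by exact hx), hex, Set.indicator_of_mem hx, hfg,
        ENNReal.ofReal_mul hc.le]
    · rw [Set.indicator_of_notMem (by exact hx), hex, Set.indicator_of_notMem hx, mul_zero]
  simp only [h2]
  rw [lintegral_const_mul' _ _ ENNReal.ofReal_ne_top, ← h1, ← mul_assoc,
    ← ENNReal.ofReal_mul hc.le, abs_of_pos (inv_pos.2 hc), mul_inv_cancel₀ hc.ne',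
    ENNReal.ofReal_one, one_mul]

theorem innerQ_eq_innerCN (hq : |q| < 1) (t : ℝ) (k j : ℕ) :
    innerQ q (2 * t / √(1 - q)) k j = (1 - q) ^ k * innerCN q t k j := by
  have h0 := (one_sub_pos_of_abs_lt_one hq).ne'
  have h1 := (qFactorial_pos hq j).ne'
  rw [innerQ, innerCN, qPoch_self_eq_qFactorial, qPoch_self_eq_qFactorial, pow_add]
  field_simp

theorem outerCN_eq (hq : |q| < 1) (y ρ t : ℝ) (k : ℕ) :
    outerCN y ρ q t k = rsSeq q (ρ * (√(1 - q) * y)) (ρ ^ 2) k *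
      ∑' j, innerQ q (2 * t / √(1 - q)) k j := by
  have h := qPoch_mul_rsSeq_eq_qHermite hq ρ y k
  have h1 := (qFactorial_pos hq k).ne'
  rw [qPoch_self_eq_qFactorial] at h
  simp only [innerQ_eq_innerCN hq, tsum_mul_left]
  rw [outerCN]
  generalize rsSeq q (ρ * (√(1 - q) * y)) (ρ ^ 2) k = R at h ⊢
  field_simp
  linear_combination (-∑' j, innerCN q t k j) * h

theorem outerQ_eq (hq : |q| < 1) (a b t : ℝ) (k : ℕ) :
    outerQ a b q t k = rsSeq q (a + b) (a * b) k * ∑' j, innerQ q t k j := by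
  have h := (qPoch_self_pos hq k).ne'
  rw [outerQ, qS_eq_qPoch_mul_rsSeq hq, mul_div_cancel_left₀ _ h]

end

/-! ### Specialisation to the conditional q-Normal law and to f_Q -/

theorem proposition3 {Ω : Type*} [MeasurableSpace Ω] (P : Measure Ω) (X : Ω → ℝ)
    (q : ℝ) (hq : |q| < 1) :
    (∀ y ρ : ℝ, y ∈ qInterval q → |ρ| < 1 →
      HasLaw X (measureOfDensity (densityCN y ρ q)) P →
        (∀ n : ℕ, Integrable (fun ω => X ω ^ n) P ∧
          ∫ ω, X ω ^ n ∂P = ∑ m ∈ Finset.range (n / 2 + 1),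
            ((1 - q) ^ m)⁻¹ * ρ ^ (n - 2 * m) * qHermite q (n - 2 * m) y * qCoeff m n q) ∧
        (∀ t : ℝ, t ≠ 0 →
          Integrable (fun ω => Real.exp (t * X ω)) P ∧
          (∀ k : ℕ, Summable (innerCN q t k)) ∧ Summable (outerCN y ρ q t) ∧
          mgf X P t = √(1 - q) / t * ∑' k : ℕ, outerCN y ρ q t k)) ∧
    (∀ a b : ℝ, |a| < 1 → |b| < 1 →
      HasLaw X (measureOfDensity (densityQ a b q)) P →
        (∀ n : ℕ, Integrable (fun ω => X ω ^ n) P ∧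
          ∫ ω, X ω ^ n ∂P = 1 / 2 ^ n * ∑ j ∈ Finset.range (n / 2 + 1),
            qCoeff j n q * qS (n - 2 * j) a b q) ∧
        (∀ t : ℝ, t ≠ 0 →
          Integrable (fun ω => Real.exp (t * X ω)) P ∧
          (∀ k : ℕ, Summable (innerQ q t k)) ∧ Summable (outerQ a b q t) ∧
          mgf X P t = 2 / t * ∑' k : ℕ, outerQ a b q t k)) := by
  have h1q := one_sub_pos_of_abs_lt_one hq
  have hr : 0 < √(1 - q) := Real.sqrt_pos.2 h1q
  have hr2 : √(1 - q) ^ 2 = 1 - q := Real.sq_sqrt h1q.le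
  constructor
  · intro y ρ hy hρ hX
    obtain ⟨a, b, ha, hb, hs, hp, hab⟩ := exists_conj_params hq hρ hy
    obtain ⟨hmom, hmgf⟩ := ascLaw hq ha hb hs hp
      (fun x hx k => ascFactor_nonneg_of_conj hs hp hab hx k)
      (HasLaw.const_mul_of_density (half_pos hr) (densityCN_eq_ascDensity hq hρ hy) hX)
    refine ⟨fun n => ?_, fun t ht => ?_⟩
    · obtain ⟨h1, h2⟩ := hmom n
      have hc : (√(1 - q) / 2) ^ n ≠ 0 := (pow_pos (half_pos hr) n).ne'
      simp only [mul_pow (√(1 - q) / 2)] at h1 h2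
      refine ⟨by simpa [hc] using h1.const_mul ((√(1 - q) / 2) ^ n)⁻¹, ?_⟩
      rw [integral_const_mul] at h2
      apply mul_left_cancel₀ hc
      rw [h2, Finset.mul_sum, Finset.mul_sum]
      refine Finset.sum_congr rfl fun m hm => ?_
      rw [qPoch_mul_rsSeq_eq_qHermite hq]
      obtain ⟨k, rfl⟩ : ∃ k, n = k + 2 * m := ⟨n - 2 * m, by rw [Finset.mem_range] at hm; omega⟩
      rw [Nat.add_sub_cancel, div_pow, pow_add √(1 - q), pow_mul √(1 - q), hr2]
      have := (pow_pos h1q m).ne'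
      field_simp
    · have hinner : ∀ k, Summable (innerCN q t k) := fun k => by
        have h := summable_innerQ hq (2 * t / √(1 - q)) k
        rw [funext (innerQ_eq_innerCN hq t k), summable_mul_left_iff (pow_pos h1q k).ne'] at h
        exact h
      have htX : ∀ ω, 2 * t / √(1 - q) * (√(1 - q) / 2 * X ω) = t * X ω := fun ω => by
        field_simp
      -- The rescaled variable is √(1-q) X / 2, so this argument restores e^{tX}.
      obtain ⟨h1, h2⟩ := hmgf (2 * t / √(1 - q)) (by positivity)
      simp only [mgf, htX] at h1 h2
      rw [← funext (outerCN_eq hq y ρ t)] at h2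
      refine ⟨h1, hinner, h2.summable, ?_⟩
      rw [h2.tsum_eq, mgf]
      field_simp
  · intro a b ha hb hX
    rw [densityQ_eq_ascDensity] at hX
    obtain ⟨hmom, hmgf⟩ := ascLaw hq (a := a) (b := b) (by simpa using ha) (by simpa using hb)
      (by simp) (by simp)
      (fun x hx k => smallW_eq_ascFactor k x a b q ▸ smallW_nonneg k hx a b q) hX
    refine ⟨fun n => ?_, fun t ht => ?_⟩
    · simpa only [qS_eq_qPoch_mul_rsSeq hq] using hmom n
    · obtain ⟨h1, h2⟩ := hmgf t ht
      rw [← funext (outerQ_eq hq a b t)] at h2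
      refine ⟨h1, summable_innerQ hq t, h2.summable, ?_⟩
      rw [h2.tsum_eq]
      field_simp
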